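/- **Min $k$-Shrinking to Independence.** An instance is $\mathcal I=(P,k,\alpha,\mu)$, where $P\subset\mathbb R^2$ is a set of $n$ points, $k\ge 0$ is an integer, $0\le\alpha\le 1$ and $\mu\ge 0$ are real. A *solution* is a pair $(S,r)$ with $S\subseteq P$, $|S|\le k$, $r\colon P\to\mathbb R_{\ge 0}$, $r(p)=1$ for $p\notin S$, $\alpha\le r(p)\le 1$ for $p\in S$, such that the intersection graph of the open disks with centre $p$ and radius $r(p)$, $p\in P$, is edgeless (a disk of radius $0$ counts as its centre, so that distinct $p,q$ are adjacent if and only if $|pq|<r(p)+r(q)$), and $\mathrm{cost}(S,r)=\sum_{p\in S}(1-r(p))\le\mu$. The instance is a yes-instance if it has a solution; an *optimal solution* is one of minimum cost. **Theorem.** There is a single real RAM program (unit cost; exact $+,-,\times,/,\sqrt{\phantom{x}}$ and comparison of real numbers; addition, truncated subtraction and comparison of natural numbers; indirect addressing; integer constants only; no rounding) that, on every instance $\mathcal I=(P,k,\alpha,\mu)$, halts after at most $k^{O(k)}\cdot n^{O(1)}$ steps and correctly decides whether $\mathcal I$ is a yes-instance; if $\mathcal I$ is a yes-instance, it also returns an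 optimal solution. Precisely, there are constants $C,c\in\mathbb N$, independent of the instance, such that the number of steps is at most $C\cdot k^{ck}\cdot(n+1)^c$ (with $0^0=1$). -/

import Mathlib

/-! ## The real RAM

A real RAM has a memory for natural numbers (used for counting and addressing) and a memory for
real numbers; each is organised in arrays of unbounded length.  Programs are `while`-programs.
Natural numbers are only added, subtracted and compared; real numbers undergo exact `+`, `-`, `*`,
`/`, square root and comparison.  There is no conversion from reals to naturals (no floor), and the
only literals are integers.  Every operation, memory access, literal, test and control step costs
one time unit. -/

namespace RealRAM

/-- Memory contents: `nat a i` and `real a i` are the `i`-th cells of the `a`-th arrays. -/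
structure Store where
  nat : ℕ → ℕ → ℕ
  real : ℕ → ℕ → ℝ

/-- Expressions with natural-number values. `read a i` is the cell of array `a` with the (computed)
address `i`. -/
inductive NExp where
  | lit (m : ℕ)
  | read (a : ℕ) (i : NExp)
  | add (e f : NExp)
  | sub (e f : NExp)

/-- Expressions with real values. -/
inductive RExp where
  | lit (z : ℤ)
  | read (a : ℕ) (i : NExp)
  | add (e f : RExp)
  | sub (e f : RExp)
  | mul (e f : RExp)
  | div (e f : RExp)
  | sqrt (e : RExp)

/-- Tests. -/
inductive Test where
  | natLe (e f : NExp)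
  | realLe (e f : RExp)
  | not (b : Test)
  | and (b c : Test)

/-- Programs. -/
inductive Prog where
  | skip
  | setNat (a : ℕ) (i e : NExp)
  | setReal (a : ℕ) (i : NExp) (e : RExp)
  | seq (p q : Prog)
  | ite (b : Test) (p q : Prog)
  | loop (b : Test) (p : Prog)

/-- Value of a natural-number expression; subtraction is truncated at `0`. -/
def NExp.eval (s : Store) : NExp → ℕ
  | .lit m => m
  | .read a i => s.nat a (i.eval s)
  | .add e f => e.eval s + f.eval s
  | .sub e f => e.eval s - f.eval s

/-- Evaluation time of a natural-number expression. -/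
def NExp.cost : NExp → ℕ
  | .lit _ => 1
  | .read _ i => i.cost + 1
  | .add e f => e.cost + f.cost + 1
  | .sub e f => e.cost + f.cost + 1

/-- Value of a real expression; division by zero and square roots of negative numbers give `0`. -/
noncomputable def RExp.eval (s : Store) : RExp → ℝ
  | .lit z => (z : ℝ)
  | .read a i => s.real a (i.eval s)
  | .add e f => e.eval s + f.eval s
  | .sub e f => e.eval s - f.eval s
  | .mul e f => e.eval s * f.eval s
  | .div e f => e.eval s / f.eval s
  | .sqrt e => Real.sqrt (e.eval s)

/-- Evaluation time of a real expression. -/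
def RExp.cost : RExp → ℕ
  | .lit _ => 1
  | .read _ i => i.cost + 1
  | .add e f => e.cost + f.cost + 1
  | .sub e f => e.cost + f.cost + 1
  | .mul e f => e.cost + f.cost + 1
  | .div e f => e.cost + f.cost + 1
  | .sqrt e => e.cost + 1

/-- Truth of a test. -/
def Test.Holds (s : Store) : Test → Prop
  | .natLe e f => e.eval s ≤ f.eval s
  | .realLe e f => e.eval s ≤ f.eval s
  | .not b => ¬ b.Holds s
  | .and b c => b.Holds s ∧ c.Holds s

/-- Evaluation time of a test. -/
def Test.cost : Test → ℕ
  | .natLe e f => e.cost + f.cost + 1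
  | .realLe e f => e.cost + f.cost + 1
  | .not b => b.cost + 1
  | .and b c => b.cost + c.cost + 1

/-- Store `v` in cell `i` of the array `a` of naturals. -/
def Store.writeNat (s : Store) (a i v : ℕ) : Store :=
  { s with nat := Function.update s.nat a (Function.update (s.nat a) i v) }

/-- Store `x` in cell `i` of the array `a` of reals. -/
def Store.writeReal (s : Store) (a i : ℕ) (x : ℝ) : Store :=
  { s with real := Function.update s.real a (Function.update (s.real a) i x) }

/-- `Run p s t s'`: program `p`, started on the memory contents `s`, halts after exactly `t` time
units with memory contents `s'`. -/
inductive Run : Prog → Store → ℕ → Store → Prop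
  | skip (s : Store) : Run .skip s 1 s
  | setNat (a : ℕ) (i e : NExp) (s : Store) :
      Run (.setNat a i e) s (i.cost + e.cost + 1) (s.writeNat a (i.eval s) (e.eval s))
  | setReal (a : ℕ) (i : NExp) (e : RExp) (s : Store) :
      Run (.setReal a i e) s (i.cost + e.cost + 1) (s.writeReal a (i.eval s) (e.eval s))
  | seq {p q : Prog} {s s' s'' : Store} {t u : ℕ} :
      Run p s t s' → Run q s' u s'' → Run (.seq p q) s (t + u) s''
  | iteTrue {b : Test} {p q : Prog} {s s' : Store} {t : ℕ} :
      b.Holds s → Run p s t s' → Run (.ite b p q) s (b.cost + 1 + t) s'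
  | iteFalse {b : Test} {p q : Prog} {s s' : Store} {t : ℕ} :
      ¬ b.Holds s → Run q s t s' → Run (.ite b p q) s (b.cost + 1 + t) s'
  | loopStop {b : Test} {p : Prog} {s : Store} :
      ¬ b.Holds s → Run (.loop b p) s (b.cost + 1) s
  | loopStep {b : Test} {p : Prog} {s s' s'' : Store} {t u : ℕ} :
      b.Holds s → Run p s t s' → Run (.loop b p) s' u s'' →
      Run (.loop b p) s (b.cost + 1 + t + u) s''

end RealRAM

/-! ## Disk graphs -/

/-- The Euclidean plane. -/
abbrev Plane : Type := EuclideanSpace ℝ (Fin 2)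

/-- The open disk with centre `c` and radius `r ≥ 0`; a disk of radius `0` is the single point `c`
(shrinking a disk to radius `0` does not delete it). -/
def openDisk (c : Plane) (r : ℝ) : Set Plane := insert c (Metric.ball c r)

/-- The intersection graph of the disks with centres `p i` and radii `r i`. -/
def diskGraph {ι : Type*} (p : ι → Plane) (r : ι → ℝ) : SimpleGraph ι where
  Adj i j := i ≠ j ∧ (openDisk (p i) (r i) ∩ openDisk (p j) (r j)).Nonempty
  symm := ⟨fun i j h => ⟨h.1.symm, by rw [Set.inter_comm]; exact h.2⟩⟩
  loopless := ⟨fun _ h => h.1 rfl⟩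

/-! ## Min k-Shrinking to Independence -/

/-- An instance: `n` distinct points of the plane, `k ∈ ℕ`, `0 ≤ α ≤ 1` and a budget `μ ≥ 0`. -/
structure MinShrinkInstance where
  n : ℕ
  point : Fin n → Plane
  point_injective : Function.Injective point
  k : ℕ
  α : ℝ
  α_nonneg : 0 ≤ α
  α_le_one : α ≤ 1
  μ : ℝ
  μ_nonneg : 0 ≤ μ

namespace MinShrinkInstance

/-- The total change of the radii. -/
def solCost {n : ℕ} (S : Finset (Fin n)) (r : Fin n → ℝ) : ℝ := ∑ p ∈ S, (1 - r p)

/-- `(S, r)` is a solution of the instance `I`. -/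
structure IsSolution (I : MinShrinkInstance) (S : Finset (Fin I.n)) (r : Fin I.n → ℝ) : Prop where
  card_le : S.card ≤ I.k
  radius_of_notMem : ∀ p, p ∉ S → r p = 1
  radius_of_mem : ∀ p, p ∈ S → I.α ≤ r p ∧ r p ≤ 1
  edgeless : diskGraph I.point r = ⊥
  cost_le : solCost S r ≤ I.μ

/-- `I` is a yes-instance. -/
def IsYes (I : MinShrinkInstance) : Prop := ∃ S r, I.IsSolution S r

/-- `(S, r)` is a solution of minimum cost. -/
def IsOptimalSolution (I : MinShrinkInstance) (S : Finset (Fin I.n)) (r : Fin I.n → ℝ) : Prop :=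
  I.IsSolution S r ∧ ∀ S' r', I.IsSolution S' r' → solCost S r ≤ solCost S' r'

/-- The memory at the start: `n` and `k` in cells `0` and `1` of array `0` of naturals, `α` and `μ`
in cells `0` and `1` of array `0` of reals, the first and second coordinates of the points in
arrays `1` and `2` of reals; all other cells are `0`. -/
noncomputable def input (I : MinShrinkInstance) : RealRAM.Store where
  nat a j := if a = 0 ∧ j = 0 then I.n else if a = 0 ∧ j = 1 then I.k else 0
  real a j :=
    if a = 0 ∧ j = 0 then I.α
    else if a = 0 ∧ j = 1 then I.μ
    else if h : j < I.n then
      if a = 1 then I.point ⟨j, h⟩ 0 else if a = 2 then I.point ⟨j, h⟩ 1 else 0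
    else 0

/-- The answer of a halted program: cell `0` of array `1` of naturals (`1` for yes, `0` for no). -/
def outAnswer (s : RealRAM.Store) : ℕ := s.nat 1 0

/-- The returned set: the points whose cell in array `2` of naturals is `1`. -/
def outSet (n : ℕ) (s : RealRAM.Store) : Finset (Fin n) :=
  Finset.univ.filter fun i => s.nat 2 i = 1

/-- The returned radii, in array `3` of reals. -/
def outRadius (n : ℕ) (s : RealRAM.Store) : Fin n → ℝ := fun i => s.real 3 i

end MinShrinkInstance

/-! ## A program logic with running times for the real RAM -/

namespace RealRAM

/-! Put `x p = 1 - r p`. A solution is then a point of the polyhedron `0 ≤ x p ≤ U`, `x p + x q ≥ 2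
- |pq|`, with `U = 1 - α` and at most `k` nonzero coordinates, and the cost is the sum of the
coordinates.

Kernel. The shrunken points cover every pair at distance less than 2. Points outside the cover are
pairwise at distance at least 2, so only boundedly many of them lie near a given point of the cover.
Hence a yes-instance has `m ≤ 17k` points with a close neighbour (`card_nonisolated_le`), and only
these ever have to shrink.

Candidates. Two copies of each such point, with constraints between opposite copies only, make the
system bipartite, with `N = 2m` variables. There, variables not linked by tight constraints to a
variable at a bound can be shifted in opposite directions on the two sides, without raising the
cost, until one more is linked (`IsCover.exists_grounded`). When all are linked, the solution arises
from 0 by at most `N` assignments `x v := U` or `x v := w v v' - x v'` (`exists_straightLine_eq`).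
Averaging the two copies returns to the original system at no greater cost. Capping variables by 0
wherever the given solution vanishes keeps the support from growing, so the shrunken set need not be
guessed (`exists_straightLine_radii`).

Search. Such a computation is a string of `4m` digits to the base `2m + 2`. The program rejects if
`m > 17k`. Otherwise it runs through all strings with an odometer, checks each resulting choice of
radii directly against the definition of a solution, and keeps the cheapest. Soundness is thus
immediate, completeness is `IsSolution.exists_candidate`, and there are at most `(34k + 2) ^ (68k)`
strings (`searchSpace_le`). -/

@[simp] theorem Store.nat_writeNat_self (s : Store) (a i v : ℕ) :
    (s.writeNat a i v).nat a = Function.update (s.nat a) i v := by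
  simp [Store.writeNat]

@[simp] theorem Store.nat_writeNat_of_ne (s : Store) {a b : ℕ} (h : b ≠ a) (i v : ℕ) :
    (s.writeNat a i v).nat b = s.nat b := by
  simp [Store.writeNat, h]

@[simp] theorem Store.real_writeNat (s : Store) (a i v : ℕ) :
    (s.writeNat a i v).real = s.real := rfl

@[simp] theorem Store.real_writeReal_self (s : Store) (a i : ℕ) (x : ℝ) :
    (s.writeReal a i x).real a = Function.update (s.real a) i x := by
  simp [Store.writeReal]

@[simp] theorem Store.real_writeReal_of_ne (s : Store) {a b : ℕ} (h : b ≠ a) (i : ℕ) (x : ℝ) :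
    (s.writeReal a i x).real b = s.real b := by
  simp [Store.writeReal, h]

@[simp] theorem Store.nat_writeReal (s : Store) (a i : ℕ) (x : ℝ) :
    (s.writeReal a i x).nat = s.nat := rfl

attribute [simp] NExp.eval RExp.eval Test.Holds NExp.cost RExp.cost Test.cost

/-- The arrays of naturals a program may write to. -/
def Prog.natMods : Prog → List ℕ
  | .skip => []
  | .setNat a _ _ => [a]
  | .setReal _ _ _ => []
  | .seq p q => p.natMods ++ q.natMods
  | .ite _ p q => p.natMods ++ q.natMods
  | .loop _ p => p.natMods

/-- The arrays of reals a program may write to. -/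
def Prog.realMods : Prog → List ℕ
  | .skip => []
  | .setNat _ _ _ => []
  | .setReal a _ _ => [a]
  | .seq p q => p.realMods ++ q.realMods
  | .ite _ p q => p.realMods ++ q.realMods
  | .loop _ p => p.realMods

/-- `s'` agrees with `s` except for the arrays of naturals in `A` and the arrays of reals in `B`. -/
structure SameOutside (A B : List ℕ) (s s' : Store) : Prop where
  nat_eq : ∀ a, a ∉ A → s'.nat a = s.nat a
  real_eq : ∀ b, b ∉ B → s'.real b = s.real b

theorem SameOutside.refl (A B : List ℕ) (s : Store) : SameOutside A B s s :=
  ⟨fun _ _ => rfl, fun _ _ => rfl⟩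

theorem SameOutside.trans {A B : List ℕ} {s s' s'' : Store} (h : SameOutside A B s s')
    (h' : SameOutside A B s' s'') : SameOutside A B s s'' :=
  ⟨fun a ha => (h'.nat_eq a ha).trans (h.nat_eq a ha),
    fun b hb => (h'.real_eq b hb).trans (h.real_eq b hb)⟩

theorem SameOutside.mono {A B A' B' : List ℕ} {s s' : Store} (h : SameOutside A B s s')
    (hA : A ⊆ A') (hB : B ⊆ B') : SameOutside A' B' s s' :=
  ⟨fun a ha => h.nat_eq a fun h => ha (hA h), fun b hb => h.real_eq b fun h => hb (hB h)⟩

/-- A program changes only the arrays it writes to. -/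
theorem Run.sameOutside {p : Prog} {s s' : Store} {t : ℕ} (h : Run p s t s') :
    SameOutside p.natMods p.realMods s s' := by
  induction h with
  | skip s => exact .refl _ _ _
  | setNat a i e s =>
    exact ⟨fun b hb => s.nat_writeNat_of_ne (by simpa [Prog.natMods] using hb) _ _,
      fun _ _ => rfl⟩
  | setReal a i e s =>
    exact ⟨fun _ _ => rfl,
      fun b hb => s.real_writeReal_of_ne (by simpa [Prog.realMods] using hb) _ _⟩
  | seq _ _ h h' =>
    exact (h.mono (List.subset_append_left _ _) (List.subset_append_left _ _)).trans
      (h'.mono (List.subset_append_right _ _) (List.subset_append_right _ _))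
  | iteTrue _ _ h =>
    exact h.mono (List.subset_append_left _ _) (List.subset_append_left _ _)
  | iteFalse _ _ h =>
    exact h.mono (List.subset_append_right _ _) (List.subset_append_right _ _)
  | loopStop _ => exact .refl _ _ _
  | loopStep _ _ _ h h' => exact SameOutside.trans h h'

/-- Started on `s`, the program `p` halts after at most `T` steps in a state satisfying `Q`. -/
def WP (p : Prog) (T : ℕ) (Q : Store → Prop) (s : Store) : Prop :=
  ∃ t s', Run p s t s' ∧ t ≤ T ∧ Q s'

variable {p q : Prog} {T T' : ℕ} {Q Q' : Store → Prop} {s : Store}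

/-- The new postcondition may use `SameOutside`, which every run satisfies by the syntax of the
program. Specifications can therefore be silent about arrays that are not written to. -/
theorem WP.mono (h : WP p T Q s) (hT : T ≤ T')
    (hQ : ∀ s', SameOutside p.natMods p.realMods s s' → Q s' → Q' s') : WP p T' Q' s := by
  obtain ⟨t, s', hr, ht, hq⟩ := h
  exact ⟨t, s', hr, ht.trans hT, hQ s' hr.sameOutside hq⟩

theorem WP.skip (h : Q s) : WP .skip 1 Q s := ⟨1, s, .skip s, le_rfl, h⟩

theorem WP.setNat {a : ℕ} {i e : NExp} (h : Q (s.writeNat a (i.eval s) (e.eval s))) :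
    WP (.setNat a i e) (i.cost + e.cost + 1) Q s :=
  ⟨_, _, .setNat a i e s, le_rfl, h⟩

theorem WP.setReal {a : ℕ} {i : NExp} {e : RExp}
    (h : Q (s.writeReal a (i.eval s) (e.eval s))) :
    WP (.setReal a i e) (i.cost + e.cost + 1) Q s :=
  ⟨_, _, .setReal a i e s, le_rfl, h⟩

theorem WP.seq (h : WP p T (fun s' => WP q T' Q s') s) : WP (.seq p q) (T + T') Q s := by
  obtain ⟨t, s', hr, ht, t', s'', hr', ht', hq⟩ := h
  exact ⟨t + t', s'', hr.seq hr', by omega, hq⟩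

theorem WP.seq' (h : WP p T Q' s)
    (h' : ∀ s', SameOutside p.natMods p.realMods s s' → Q' s' → WP q T' Q s') :
    WP (.seq p q) (T + T') Q s :=
  WP.seq (h.mono le_rfl h')

/-- Adding the bounds of the branches instead of taking their maximum loses at most a factor of two
and keeps the time bounds linear expressions. -/
theorem WP.ite {b : Test} (h : b.Holds s → WP p T Q s) (h' : ¬ b.Holds s → WP q T' Q s) :
    WP (.ite b p q) (b.cost + 1 + T + T') Q s := by
  by_cases hb : b.Holds s
  · obtain ⟨t, s', hr, ht, hq⟩ := h hb
    exact ⟨_, s', .iteTrue hb hr, by omega, hq⟩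
  · obtain ⟨t, s', hr, ht, hq⟩ := h' hb
    exact ⟨_, s', .iteFalse hb hr, by omega, hq⟩

/-- A loop that runs exactly `N - i` more times, where `i` is given by the invariant. -/
theorem WP.loop {b : Test} {Inv : ℕ → Store → Prop} {N : ℕ}
    (hcont : ∀ i < N, ∀ s, Inv i s → b.Holds s) (hexit : ∀ s, Inv N s → ¬ b.Holds s)
    (hstep : ∀ i < N, ∀ s, Inv i s → WP p T (Inv (i + 1)) s) {i : ℕ} (hi : i ≤ N) (h : Inv i s) :
    WP (.loop b p) ((N - i) * (b.cost + 1 + T) + (b.cost + 1)) (Inv N) s := by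
  induction hd : N - i generalizing i s with
  | zero =>
    obtain rfl : i = N := by omega
    exact ⟨_, s, .loopStop (hexit s h), by simp, h⟩
  | succ d ih =>
    obtain ⟨t, s', hr, ht, hq⟩ := hstep i (by omega) s h
    obtain ⟨t', s'', hr', ht', hq'⟩ := ih (i := i + 1) (by omega) hq (by omega)
    refine ⟨_, s'', .loopStep (hcont i (by omega) s h) hr hr', ?_, hq'⟩
    rw [Nat.succ_mul]
    omega

/-- `for c[0] = 0, …, a[j] - 1 do body`. -/
def forRange (c a j : ℕ) (body : Prog) : Prog :=
  .seq (.setNat c (.lit 0) (.lit 0))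
    (.loop (.not (.natLe (.read a (.lit j)) (.read c (.lit 0))))
      (.seq body (.setNat c (.lit 0) (.add (.read c (.lit 0)) (.lit 1)))))

/-- Each round costs 7 for test and control and 6 for the increment on top of the body. By `hInv`
the invariant cannot depend on the counter cell, whose value is handed to `hstep` separately;
`hstep` also compares the current memory with that before the loop. -/
theorem WP.forRange {c a j N : ℕ} {body : Prog} {Inv : ℕ → Store → Prop}
    (hac : a ∉ c :: body.natMods) (hc : c ∉ body.natMods) (hN : s.nat a j = N)
    (hInv : ∀ i s v, Inv i s → Inv i (s.writeNat c 0 v)) (h0 : Inv 0 s)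
    (hstep : ∀ i < N, ∀ s', SameOutside (c :: body.natMods) body.realMods s s' →
      s'.nat c 0 = i → Inv i s' → WP body T (Inv (i + 1)) s') :
    WP (forRange c a j body) (N * (T + 13) + 10) (Inv N) s := by
  have hac' : a ≠ c := fun h => hac (by simp [h])
  have key : WP (RealRAM.forRange c a j body) (3 + ((N - 0) * (6 + 1 + (T + 6)) + (6 + 1)))
      (fun s' => Inv N s' ∧ s'.nat c 0 = N ∧
        SameOutside (c :: body.natMods) body.realMods s s') s := by
    refine WP.seq (WP.setNat ?_)
    refine WP.loop (Inv := fun i s' => Inv i s' ∧ s'.nat c 0 = i ∧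
        SameOutside (c :: body.natMods) body.realMods s s') ?_ ?_ ?_ (Nat.zero_le N) ?_
    · rintro i hi s' ⟨-, h1, h2⟩
      simp [h1, h2.nat_eq a hac, hN, hi]
    · rintro s' ⟨-, h1, h2⟩
      simp [h1, h2.nat_eq a hac, hN]
    · rintro i hi s' ⟨h, h1, h2⟩
      refine WP.seq' (hstep i hi s' h2 h1 h) ?_
      intro s₂ hs₂ h₂
      refine WP.setNat ⟨hInv _ _ _ h₂, ?_, ?_⟩
      · simp [hs₂.nat_eq c hc, h1]
      · refine (h2.trans (hs₂.mono (List.subset_cons_self _ _) (List.Subset.refl _))).trans ⟨?_, ?_⟩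
        · intro b hb
          exact Store.nat_writeNat_of_ne _ (fun h => hb (by simp [h])) _ _
        · intro b _
          rfl
    · refine ⟨hInv _ _ _ h0, by simp, ?_, ?_⟩
      · intro b hb
        exact Store.nat_writeNat_of_ne _ (fun h => hb (by simp [h])) _ _
      · intro b _
        rfl
  refine key.mono ?_ fun s' _ h => h.1
  rw [Nat.sub_zero, show 6 + 1 + (T + 6) = T + 13 by omega]
  omega

end RealRAM

/-! ## Grounded solutions of bipartite covering systems -/

section Grounding

variable {W : Type*}

/-- `x` satisfies `0 ≤ x ≤ b` and the covering constraints `w u v ≤ x u + x v` on the edges `E`. -/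
structure IsCover (E : W → W → Prop) (w : W → W → ℝ) (b x : W → ℝ) : Prop where
  nonneg : ∀ v, 0 ≤ x v
  le : ∀ v, x v ≤ b v
  cover : ∀ u v, E u v → w u v ≤ x u + x v

/-- A variable is grounded if it is joined by a chain of tight edges to a variable with a tight
lower or upper bound. -/
inductive Grounded (E : W → W → Prop) (w : W → W → ℝ) (b x : W → ℝ) : W → Prop
  | zero {v : W} : x v = 0 → Grounded E w b x v
  | top {v : W} : x v = b v → Grounded E w b x v
  | edge {u v : W} : E u v → x u + x v = w u v → Grounded E w b x v → Grounded E w b x u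

variable [Fintype W] {E : W → W → Prop} {w : W → W → ℝ} {b x : W → ℝ}

/-- A variable that is not grounded can be grounded by shifting all such variables, up on one side
of the bipartition and down on the other. -/
theorem IsCover.exists_more_grounded (hx : IsCover E w b x) (hE : ∀ u v, E u v → E v u)
    (hw : ∀ u v, w u v = w v u) {σ : W → ℝ} (hσ : ∀ v, σ v = 1 ∨ σ v = -1)
    (hEσ : ∀ u v, E u v → σ u + σ v = 0) {D : Finset W}
    (hD : ∀ v, v ∈ D ↔ ¬ Grounded E w b x v) (hne : D.Nonempty) (hsum : ∑ v ∈ D, σ v ≤ 0) :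
    ∃ x', IsCover E w b x' ∧ ∑ v, x' v ≤ ∑ v, x v ∧
      (∀ v, Grounded E w b x v → Grounded E w b x' v) ∧
      ∃ v, Grounded E w b x' v ∧ ¬ Grounded E w b x v := by
  classical
  -- The shift moves `D` along `σ`. It is stopped by an upper bound (`A`), by zero (`B`), or by a
  -- constraint between a falling variable and one outside `D` (`C`); the step `t` is the least of
  -- these slacks.
  set A : Finset ℝ := (D.filter fun v => σ v = 1).image (fun v => b v - x v) with hA
  set B : Finset ℝ := (D.filter fun v => σ v = -1).image (fun v => x v) with hB
  set C : Finset ℝ := ((D ×ˢ Finset.univ).filter fun e : W × W =>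
    σ e.1 = -1 ∧ e.2 ∉ D ∧ E e.1 e.2).image (fun e => x e.1 + x e.2 - w e.1 e.2) with hC
  have hABC : (A ∪ B ∪ C).Nonempty := by
    obtain ⟨v, hv⟩ := hne
    rcases hσ v with h | h
    · exact ⟨b v - x v, by simp only [Finset.mem_union, hA, Finset.mem_image, Finset.mem_filter]
                           exact Or.inl (Or.inl ⟨v, ⟨hv, h⟩, rfl⟩)⟩
    · exact ⟨x v, by simp only [Finset.mem_union, hB, Finset.mem_image, Finset.mem_filter]
                     exact Or.inl (Or.inr ⟨v, ⟨hv, h⟩, rfl⟩)⟩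
  obtain ⟨t, htmem, htmin⟩ : ∃ t ∈ A ∪ B ∪ C, ∀ r ∈ A ∪ B ∪ C, t ≤ r :=
    ⟨_, Finset.min'_mem _ hABC, fun r hr => Finset.min'_le _ r hr⟩
  have hmA : ∀ v ∈ D, σ v = 1 → t ≤ b v - x v := fun v hv h => htmin _ <| by
    simp only [Finset.mem_union, hA, Finset.mem_image, Finset.mem_filter]
    exact Or.inl (Or.inl ⟨v, ⟨hv, h⟩, rfl⟩)
  have hmB : ∀ v ∈ D, σ v = -1 → t ≤ x v := fun v hv h => htmin _ <| by
    simp only [Finset.mem_union, hB, Finset.mem_image, Finset.mem_filter]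
    exact Or.inl (Or.inr ⟨v, ⟨hv, h⟩, rfl⟩)
  have hmC : ∀ u ∈ D, σ u = -1 → ∀ v, v ∉ D → E u v → t ≤ x u + x v - w u v :=
    fun u hu h v hv he => htmin _ <| by
      simp only [Finset.mem_union, hC, Finset.mem_image, Finset.mem_filter, Finset.mem_product]
      exact Or.inr ⟨(u, v), ⟨⟨hu, Finset.mem_univ _⟩, h, hv, he⟩, rfl⟩
  have htcases : (∃ v ∈ D, σ v = 1 ∧ t = b v - x v) ∨ (∃ v ∈ D, σ v = -1 ∧ t = x v) ∨
      ∃ u ∈ D, σ u = -1 ∧ ∃ v, v ∉ D ∧ E u v ∧ t = x u + x v - w u v := by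
    simp only [Finset.mem_union, hA, hB, hC, Finset.mem_image, Finset.mem_filter,
      Finset.mem_product] at htmem
    rcases htmem with (⟨v, ⟨hv, h⟩, rfl⟩ | ⟨v, ⟨hv, h⟩, rfl⟩) | ⟨⟨u, v⟩, ⟨⟨hu, _⟩, h, hv, he⟩, rfl⟩
    · exact Or.inl ⟨v, hv, h, rfl⟩
    · exact Or.inr (Or.inl ⟨v, hv, h, rfl⟩)
    · exact Or.inr (Or.inr ⟨u, hu, h, v, hv, he, rfl⟩)
  have ht0 : 0 ≤ t := by
    rcases htcases with ⟨v, _, _, rfl⟩ | ⟨v, _, _, rfl⟩ | ⟨u, _, _, v, _, he, rfl⟩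
    · linarith [hx.le v]
    · exact hx.nonneg v
    · linarith [hx.cover u v he]
  set x' : W → ℝ := fun v => x v + if v ∈ D then t * σ v else 0 with hx'
  have hin : ∀ v ∈ D, x' v = x v + t * σ v := fun v hv => by simp [hx', hv]
  have hout : ∀ v, v ∉ D → x' v = x v := fun v hv => by simp [hx', hv]
  -- All variables on a grounding chain are grounded, so none of them moves.
  have hold : ∀ v, Grounded E w b x v → Grounded E w b x' v := by
    intro v hv
    induction hv with
    | @zero v h => exact .zero (by rw [hout v (by rw [hD]; exact not_not.2 (.zero h)), h])
    | @top v h => exact .top (by rw [hout v (by rw [hD]; exact not_not.2 (.top h)), h])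
    | @edge u v he h hv ih =>
      refine .edge he ?_ ih
      rw [hout v (by rw [hD]; exact not_not.2 hv),
        hout u (by rw [hD]; exact not_not.2 (.edge he h hv)), h]
  -- A rising endpoint only adds slack; a falling one is limited by `C`.
  have mixed : ∀ u ∈ D, ∀ v, v ∉ D → E u v → w u v ≤ x' u + x' v := by
    intro u hu v hv he
    rw [hin u hu, hout v hv]
    rcases hσ u with h | h
    · rw [h]; linarith [hx.cover u v he]
    · rw [h]; linarith [hmC u hu h v hv he]
  refine ⟨x', ⟨?_, ?_, ?_⟩, ?_, hold, ?_⟩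
  · intro v
    by_cases hv : v ∈ D
    · rw [hin v hv]
      rcases hσ v with h | h
      · rw [h]; linarith [hx.nonneg v]
      · rw [h]; linarith [hmB v hv h]
    · rw [hout v hv]; exact hx.nonneg v
  · intro v
    by_cases hv : v ∈ D
    · rw [hin v hv]
      rcases hσ v with h | h
      · rw [h]; linarith [hmA v hv h]
      · rw [h]; linarith [hx.le v]
    · rw [hout v hv]; exact hx.le v
  · intro u v he
    by_cases hu : u ∈ D <;> by_cases hv : v ∈ D
    · rw [hin u hu, hin v hv]
      -- The endpoints of an edge inside `D` move by opposite amounts.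
      have : t * σ u + t * σ v = 0 := by rw [← mul_add, hEσ u v he, mul_zero]
      linarith [hx.cover u v he]
    · exact mixed u hu v hv he
    · rw [hw, add_comm]; exact mixed v hv u hu (hE _ _ he)
    · rw [hout u hu, hout v hv]; exact hx.cover u v he
  · have : ∑ v, x' v = ∑ v, x v + t * ∑ v ∈ D, σ v := by
      simp only [hx', Finset.sum_add_distrib, Finset.mul_sum]
      rw [Finset.sum_ite_mem, Finset.univ_inter]
    rw [this]
    nlinarith
  · rcases htcases with ⟨v, hv, h, ht⟩ | ⟨v, hv, h, ht⟩ | ⟨u, hu, h, v, hv, he, ht⟩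
    · exact ⟨v, .top (by rw [hin v hv, h, ht]; ring), (hD v).1 hv⟩
    · exact ⟨v, .zero (by rw [hin v hv, h, ht]; ring), (hD v).1 hv⟩
    · refine ⟨u, .edge he ?_ (hold v ?_), (hD u).1 hu⟩
      · rw [hin u hu, hout v hv, h, ht]; ring
      · by_contra hc; exact hv ((hD v).2 hc)

/-- In a bipartite covering system, every solution can be replaced by one that costs no more and in
which all variables are grounded. -/
theorem IsCover.exists_grounded (hx : IsCover E w b x) (hE : ∀ u v, E u v → E v u)
    (hw : ∀ u v, w u v = w v u) {σ : W → ℝ} (hσ : ∀ v, σ v = 1 ∨ σ v = -1)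
    (hEσ : ∀ u v, E u v → σ u + σ v = 0) :
    ∃ x', IsCover E w b x' ∧ ∑ v, x' v ≤ ∑ v, x v ∧ ∀ v, Grounded E w b x' v := by
  classical
  induction hd : (Finset.univ.filter fun v => ¬ Grounded E w b x v).card
    using Nat.strong_induction_on generalizing x with
  | _ d ih =>
    subst hd
    set D := Finset.univ.filter fun v => ¬ Grounded E w b x v with hD
    by_cases hne : D.Nonempty
    · have hmem : ∀ v, v ∈ D ↔ ¬ Grounded E w b x v := fun v => by simp [hD]
      obtain ⟨x', hx', hc, hold, v, hv, hv'⟩ : ∃ x', IsCover E w b x' ∧ ∑ v, x' v ≤ ∑ v, x v ∧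
          (∀ v, Grounded E w b x v → Grounded E w b x' v) ∧
          ∃ v, Grounded E w b x' v ∧ ¬ Grounded E w b x v := by
        -- One of the two directions does not raise the cost; the other is obtained by negating `σ`.
        rcases le_total (∑ v ∈ D, σ v) 0 with h | h
        · exact hx.exists_more_grounded hE hw hσ hEσ hmem hne h
        · refine hx.exists_more_grounded hE hw (σ := fun v => - σ v) (fun v => ?_)
            (fun u v he => by linarith [hEσ u v he]) hmem hne ?_
          · rcases hσ v with h | h <;> simp [h]
          · rw [Finset.sum_neg_distrib]; linarith
      have hlt : (Finset.univ.filter fun v => ¬ Grounded E w b x' v) ⊂ D := by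
        refine (Finset.ssubset_iff_of_subset fun u hu => ?_).2 ⟨v, (hmem v).2 hv', by simpa⟩
        rw [hmem]
        exact fun h => (Finset.mem_filter.1 hu).2 (hold u h)
      obtain ⟨x'', h1, h2, h3⟩ := ih _ (Finset.card_lt_card hlt) hx' rfl
      exact ⟨x'', h1, h2.trans hc, h3⟩
    · refine ⟨x, hx, le_rfl, fun v => ?_⟩
      by_contra h
      exact hne ⟨v, by simp [hD, h]⟩

end Grounding

/-! ## Straight-line evaluation -/

/-- Values of variables computed, starting from `0`, by successive assignments
`x (v j) := w (v j) (src j) - x (src j)` (if `src j < N`) or `x (v j) := U` (if `src j = N`). -/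
noncomputable def straightLine (w : ℕ → ℕ → ℝ) (U : ℝ) (N : ℕ) (v src : ℕ → ℕ) : ℕ → ℕ → ℝ
  | 0 => 0
  | j + 1 =>
    if src j < N then
      Function.update (straightLine w U N v src j) (v j)
        (w (v j) (src j) - straightLine w U N v src j (src j))
    else if src j ≤ N then Function.update (straightLine w U N v src j) (v j) U
    else straightLine w U N v src j

theorem straightLine_congr {w : ℕ → ℕ → ℝ} {U : ℝ} {N : ℕ} {v v' src src' : ℕ → ℕ} {j : ℕ}
    (hv : ∀ i < j, v i = v' i) (hs : ∀ i < j, src i = src' i) :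
    straightLine w U N v src j = straightLine w U N v' src' j := by
  induction j with
  | zero => rfl
  | succ j ih =>
    simp only [straightLine]
    rw [ih (fun i hi => hv i (by omega)) (fun i hi => hs i (by omega)), hv j (by omega),
      hs j (by omega)]

/-- A grounded solution, some of whose variables are known, determines one more variable. -/
theorem Grounded.exists_next {W : Type*} {E : W → W → Prop} {w : W → W → ℝ} {b x : W → ℝ} {U : ℝ}
    (hb : ∀ v, b v = 0 ∨ b v = U) {C : Finset W} (hC : ∀ v, x v = 0 → v ∈ C) {u : W}
    (hu : Grounded E w b x u) (huC : u ∉ C) :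
    ∃ v, v ∉ C ∧ (x v = U ∨ ∃ v' ∈ C, x v + x v' = w v v') := by
  induction hu with
  | @zero v h => exact absurd (hC v h) huC
  | @top v h =>
    rcases hb v with h' | h'
    · exact absurd (hC v (h.trans h')) huC
    · exact ⟨v, huC, Or.inl (h.trans h')⟩
  | @edge u v _ h _ ih =>
    -- Walk along the tight chain towards its end: the last variable before `C` is determined by its
    -- successor, and a chain that never meets `C` ends at a variable equal to `U`.
    by_cases hv : v ∈ C
    · exact ⟨u, huC, Or.inr ⟨v, hv, h⟩⟩
    · exact ih hv

/-- Grounded solutions are values of straight-line evaluations. -/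
theorem exists_straightLine_eq {N : ℕ} {E : Fin N → Fin N → Prop} {w : ℕ → ℕ → ℝ}
    {b x : Fin N → ℝ} {U : ℝ} (hb : ∀ v, b v = 0 ∨ b v = U)
    (hx : ∀ v, Grounded E (fun u v => w u v) b x v) :
    ∃ v src : ℕ → ℕ, (∀ j, v j < N + 2) ∧ (∀ j, src j < N + 2) ∧
      ∀ u : Fin N, straightLine w U N v src N u = x u := by
  have key : ∀ j : ℕ, ∃ v src : ℕ → ℕ, ∃ C : Finset (Fin N), (∀ j, v j < N + 2) ∧
      (∀ j, src j < N + 2) ∧ (∀ u, x u = 0 → u ∈ C) ∧ (C = Finset.univ ∨ j ≤ C.card) ∧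
      ∀ u ∈ C, straightLine w U N v src j u = x u := by
    intro j
    induction j with
    | zero =>
      -- Vanishing variables need no assignment, since the evaluation starts from 0.
      refine ⟨fun _ => 0, fun _ => 0, Finset.univ.filter fun u => x u = 0, by simp, by simp,
        by simp, by simp, fun u hu => ?_⟩
      simp [straightLine, (Finset.mem_filter.1 hu).2]
    | succ j ih =>
      obtain ⟨v, src, C, hv, hs, h0, hcard, hC⟩ := ih
      have ext : ∀ a c : ℕ, a < N + 2 → c < N + 2 →
          (∀ i, Function.update v j a i < N + 2) ∧ (∀ i, Function.update src j c i < N + 2) ∧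
          straightLine w U N (Function.update v j a) (Function.update src j c) j =
            straightLine w U N v src j := by
        intro a c ha hc
        refine ⟨fun i => ?_, fun i => ?_, straightLine_congr (fun i hi => ?_) (fun i hi => ?_)⟩
        · by_cases h : i = j
          · simp [h, ha]
          · simp [h, hv]
        · by_cases h : i = j
          · simp [h, hc]
          · simp [h, hs]
        · simp [hi.ne]
        · simp [hi.ne]
      by_cases hCu : C = Finset.univ
      · obtain ⟨h1, h2, h3⟩ := ext 0 (N + 1) (by omega) (by omega)
        refine ⟨_, _, C, h1, h2, h0, Or.inl hCu, fun u hu => ?_⟩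
        simp [straightLine, h3, hC u hu]
      · obtain ⟨u, hu⟩ : ∃ u, u ∉ C := by
          by_contra! h
          exact hCu (Finset.eq_univ_of_forall h)
        obtain ⟨u, hu, hcase⟩ := (hx u).exists_next hb h0 hu
        have hcard' : j + 1 ≤ (insert u C).card := by
          rw [Finset.card_insert_of_notMem hu]
          have := hcard.resolve_left hCu
          omega
        rcases hcase with hU | ⟨v', hv', hvw⟩
        · obtain ⟨h1, h2, h3⟩ := ext u N (by omega) (by omega)
          refine ⟨_, _, insert u C, h1, h2, fun a ha => Finset.mem_insert_of_mem (h0 a ha),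
            Or.inr hcard', fun a ha => ?_⟩
          simp only [straightLine, h3, Function.update_self, lt_irrefl, if_false, le_rfl, if_true]
          rcases Finset.mem_insert.1 ha with rfl | ha
          · simp [hU]
          · have : (a : ℕ) ≠ u := fun h => hu (Fin.ext h ▸ ha)
            simp [this, hC a ha]
        · obtain ⟨h1, h2, h3⟩ := ext u v' (by omega) (by omega)
          refine ⟨_, _, insert u C, h1, h2, fun a ha => Finset.mem_insert_of_mem (h0 a ha),
            Or.inr hcard', fun a ha => ?_⟩
          simp only [straightLine, h3, Function.update_self, v'.2, if_true]
          rcases Finset.mem_insert.1 ha with rfl | ha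
          · rw [Function.update_self, hC v' hv']
            linarith
          · have : (a : ℕ) ≠ u := fun h => hu (Fin.ext h ▸ ha)
            simp [this, hC a ha]
  obtain ⟨v, src, C, hv, hs, -, hcard, hC⟩ := key N
  have hCu : C = Finset.univ := by
    rcases hcard with h | h
    · exact h
    · exact Finset.eq_univ_of_card _ (le_antisymm (Finset.card_le_univ _) (by simpa using h))
  exact ⟨v, src, hv, hs, fun u => hC u (by simp [hCu])⟩

/-! ### Averaging over the double cover -/

/-- Radii with `r (q u) = 1 - (x u + x (m + u)) / 2` for `u < l`; the other radii are `1`. -/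
noncomputable def radiiOf (q : ℕ → ℕ) (m : ℕ) (x : ℕ → ℝ) : ℕ → ℕ → ℝ
  | 0 => fun _ => 1
  | l + 1 => Function.update (radiiOf q m x l) (q l) (1 - (x l + x (m + l)) / 2)

/-- Injectivity ensures that no later update overwrites the entry. -/
theorem radiiOf_apply {q : ℕ → ℕ} {m l : ℕ} {x : ℕ → ℝ} (hq : Set.InjOn q (Set.Iio l)) {u : ℕ}
    (hu : u < l) : radiiOf q m x l (q u) = 1 - (x u + x (m + u)) / 2 := by
  induction l with
  | zero => omega
  | succ l ih =>
    by_cases h : u = l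
    · subst h; simp [radiiOf]
    · have : q u ≠ q l := fun h' => h (hq (Set.mem_Iio.2 hu) (Set.mem_Iio.2 (Nat.lt_succ_self l)) h')
      rw [radiiOf, Function.update_of_ne this]
      exact ih (hq.mono (Set.Iio_subset_Iio (Nat.le_succ l))) (by omega)

theorem radiiOf_of_forall_ne {q : ℕ → ℕ} {m l : ℕ} {x : ℕ → ℝ} {i : ℕ} (hi : ∀ u < l, q u ≠ i) :
    radiiOf q m x l i = 1 := by
  induction l with
  | zero => rfl
  | succ l ih =>
    rw [radiiOf, Function.update_of_ne (hi l (by omega)).symm]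
    exact ih fun u hu => hi u (by omega)

/-- Every solution of the covering constraints `2 - δ i j ≤ x i + x j` can be replaced by one that
is no more costly, has no larger support, and comes from a straight-line evaluation on the double
cover. -/
theorem exists_straightLine_radii {n m : ℕ} {q : ℕ → ℕ} {δ : ℕ → ℕ → ℝ} {U : ℝ} {x : ℕ → ℝ}
    (hδ : ∀ i j, δ i j = δ j i) (hqn : ∀ u < m, q u < n) (hq : Set.InjOn q (Set.Iio m))
    (hqm : ∀ u < m, q (m + u) = q u)
    (hcov : ∀ i < n, ∀ j < n, i ≠ j → δ i j < 2 → ∃ u < m, q u = i)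
    (hx0 : ∀ i < n, 0 ≤ x i) (hxU : ∀ i < n, x i ≤ U)
    (hx : ∀ i < n, ∀ j < n, i ≠ j → 2 - δ i j ≤ x i + x j) :
    ∃ v src : ℕ → ℕ, (∀ j, v j < m + m + 2) ∧ (∀ j, src j < m + m + 2) ∧
      ∀ r, r = radiiOf q m (straightLine (fun a c => 2 - δ (q a) (q c)) U (m + m) v src (m + m)) m →
        (∀ i < n, r i ≤ 1 ∧ 1 - r i ≤ U) ∧
        (∀ i < n, ∀ j < n, i ≠ j → r i + r j ≤ δ i j) ∧
        (∀ i < n, r i < 1 → x i ≠ 0) ∧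
        ∑ i ∈ Finset.range n, (1 - r i) ≤ ∑ i ∈ Finset.range n, x i := by
  classical
  have hqlt : ∀ u : Fin (m + m), q u < n := by
    intro u
    by_cases h : (u : ℕ) < m
    · exact hqn u h
    · have := hqm (u - m) (by omega)
      rw [show m + ((u : ℕ) - m) = u by omega] at this
      rw [this]; exact hqn _ (by omega)
  -- The double cover: indices below and from `m` on are the two copies, and edges join opposite
  -- copies of different points. Pairs at distance at least 2 may stay, as their demand `2 - δ` is
  -- not positive.
  set E : Fin (m + m) → Fin (m + m) → Prop := fun u v =>
    ((u : ℕ) < m ↔ ¬ (v : ℕ) < m) ∧ q u ≠ q v with hE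
  -- The cap 0 where `x` vanishes keeps the support from growing. A variable at this cap is at 0
  -- anyway, so the evaluation needs no constant besides `U`.
  set b : Fin (m + m) → ℝ := fun u => if x (q u) = 0 then 0 else U with hb
  have hcover : IsCover E (fun u v => 2 - δ (q u) (q v)) b (fun u => x (q u)) := by
    refine ⟨fun u => hx0 _ (hqlt u), fun u => ?_, fun u v he => hx _ (hqlt u) _ (hqlt v) he.2⟩
    simp only [hb]
    split_ifs with h
    · exact h.le
    · exact hxU _ (hqlt u)
  obtain ⟨y, hy, hcost, hgr⟩ := hcover.exists_grounded (fun u v h => ⟨by tauto, h.2.symm⟩)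
    (fun u v => by rw [hδ]) (σ := fun u => if (u : ℕ) < m then 1 else -1)
    (fun v => by by_cases h : (v : ℕ) < m <;> simp [h])
    (fun u v he => by
      by_cases h : (u : ℕ) < m
      · simp [if_pos h, if_neg (he.1.1 h)]
      · simp [if_neg h, if_pos (not_not.1 (mt he.1.2 h))])
  obtain ⟨v, src, hv, hs, hval⟩ := exists_straightLine_eq
    (w := fun a c => 2 - δ (q a) (q c)) (U := U)
    (fun u => by by_cases h : x (q u) = 0 <;> simp [hb, h]) hgr
  refine ⟨v, src, hv, hs, ?_⟩
  rintro r rfl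
  set r := radiiOf q m (straightLine (fun a c => 2 - δ (q a) (q c)) U (m + m) v src (m + m)) m
    with hr
  have hr1 : ∀ u : Fin m, r (q u) = 1 - (y (Fin.castAdd m u) + y (Fin.natAdd m u)) / 2 := by
    intro u
    rw [hr, radiiOf_apply hq u.2, ← hval, ← hval]
    rfl
  have hr2 : ∀ i, (∀ u < m, q u ≠ i) → r i = 1 := fun i hi => radiiOf_of_forall_ne hi
  have hcase : ∀ i, (∃ u : Fin m, q u = i) ∨ r i = 1 := by
    intro i
    by_cases h : ∃ u : Fin m, q u = i
    · exact Or.inl h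
    · exact Or.inr (hr2 i fun u hu h' => h ⟨⟨u, hu⟩, h'⟩)
  have hb1 : ∀ u : Fin m, b (Fin.castAdd m u) = if x (q u) = 0 then 0 else U := fun u => rfl
  have hb2 : ∀ u : Fin m, b (Fin.natAdd m u) = if x (q u) = 0 then 0 else U := fun u => by
    rw [← hqm u u.2]
    rfl
  have hU : ∀ i < n, 0 ≤ U := fun i hi => (hx0 i hi).trans (hxU i hi)
  have hle1 : ∀ i, r i ≤ 1 := by
    intro i
    rcases hcase i with ⟨u, rfl⟩ | h
    · rw [hr1]; linarith [hy.nonneg (Fin.castAdd m u), hy.nonneg (Fin.natAdd m u)]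
    · exact h.le
  refine ⟨fun i hi => ⟨hle1 i, ?_⟩, fun i hi j hj hij => ?_, fun i hi hri h0 => ?_, ?_⟩
  · rcases hcase i with ⟨u, rfl⟩ | h
    · have h1 := hy.le (Fin.castAdd m u)
      have h2 := hy.le (Fin.natAdd m u)
      rw [hb1] at h1
      rw [hb2] at h2
      have := hU _ hi
      rw [hr1]
      split_ifs at h1 h2 <;> linarith
    · rw [h]; simpa using hU i hi
  -- For a close pair, the constraints on its two edges in the double cover add up to twice the
  -- wanted inequality; for a distant pair, radii at most 1 suffice.
  · by_cases hd : δ i j < 2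
    · obtain ⟨u, hu, rfl⟩ := hcov i hi j hj hij hd
      obtain ⟨u', hu', rfl⟩ := hcov j hj _ hi hij.symm (by rwa [hδ])
      have e1 := hr1 ⟨u, hu⟩
      have e2 := hr1 ⟨u', hu'⟩
      have c1 := hy.cover (Fin.castAdd m ⟨u, hu⟩) (Fin.natAdd m ⟨u', hu'⟩)
        ⟨iff_of_true hu (not_lt.2 (Nat.le_add_right _ _)),
          fun h => hij (h.trans (hqm u' hu'))⟩
      have c2 := hy.cover (Fin.natAdd m ⟨u, hu⟩) (Fin.castAdd m ⟨u', hu'⟩)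
        ⟨iff_of_false (not_lt.2 (Nat.le_add_right _ _)) (not_not.2 hu'),
          fun h => hij ((hqm u hu).symm.trans h)⟩
      simp only [Fin.val_castAdd, Fin.val_natAdd, hqm u hu, hqm u' hu'] at c1 c2 e1 e2
      linarith
    · linarith [hle1 i, hle1 j]
  · rcases hcase i with ⟨u, rfl⟩ | h
    · have h1 := hy.le (Fin.castAdd m u)
      have h2 := hy.le (Fin.natAdd m u)
      rw [hb1, if_pos h0] at h1
      rw [hb2, if_pos h0] at h2
      rw [hr1] at hri
      linarith
    · linarith
  · set I := (Finset.univ : Finset (Fin m)).image (fun u : Fin m => q u) with hI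
    have hIn : I ⊆ Finset.range n := by
      intro i hi
      obtain ⟨u, -, rfl⟩ := Finset.mem_image.1 hi
      exact Finset.mem_range.2 (hqn u u.2)
    have hinj : Set.InjOn (fun u : Fin m => q u) (Finset.univ : Finset (Fin m)) := by
      intro u _ u' _ h
      exact Fin.ext (hq u.2 u'.2 h)
    calc ∑ i ∈ Finset.range n, (1 - r i) = ∑ i ∈ I, (1 - r i) := by
          refine (Finset.sum_subset hIn fun i _ hi => ?_).symm
          rw [(hcase i).resolve_left fun ⟨u, hu⟩ => hi (Finset.mem_image.2 ⟨u, by simp, hu⟩),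
            sub_self]
      _ = ∑ u : Fin m, (1 - r (q u)) := Finset.sum_image hinj
      _ = (∑ u, y u) / 2 := by
          rw [Fin.sum_univ_add, ← Finset.sum_add_distrib, Finset.sum_div]
          exact Finset.sum_congr rfl fun u _ => by rw [hr1]; ring
      -- Grounding started from `x` placed on both copies and did not raise that sum.
      _ ≤ (∑ u : Fin (m + m), x (q u)) / 2 := by linarith
      _ = ∑ u : Fin m, x (q u) := by
          rw [Fin.sum_univ_add, ← Finset.sum_add_distrib, Finset.sum_div]
          exact Finset.sum_congr rfl fun u _ => by
            rw [Fin.val_natAdd, hqm u u.2, Fin.val_castAdd, add_self_div_two]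
      _ = ∑ i ∈ I, x i := (Finset.sum_image hinj).symm
      _ ≤ ∑ i ∈ Finset.range n, x i :=
          Finset.sum_le_sum_of_subset_of_nonneg hIn fun i hi _ => hx0 i (Finset.mem_range.1 hi)

/-! ## Disks in the plane -/

theorem Plane.dist_eq (x y : Plane) :
    dist x y = √((x 0 - y 0) * (x 0 - y 0) + (x 1 - y 1) * (x 1 - y 1)) := by
  rw [EuclideanSpace.dist_eq, Fin.sum_univ_two]
  simp only [Real.dist_eq, sq_abs]
  simp only [sq]

/-- A ball of radius 0 is empty, so for a degenerate disk its centre serves as the common point;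
otherwise the criterion for balls applies. -/
theorem openDisk_inter_nonempty_iff {x y : Plane} (hxy : x ≠ y) {a b : ℝ} (ha : 0 ≤ a)
    (hb : 0 ≤ b) : (openDisk x a ∩ openDisk y b).Nonempty ↔ dist x y < a + b := by
  constructor
  · rintro ⟨z, rfl | hz, hz' | hz'⟩
    · exact absurd hz' hxy
    · rw [Metric.mem_ball] at hz'; linarith
    · rw [Metric.mem_ball] at hz
      subst hz'
      rw [dist_comm]; linarith
    · rw [Metric.mem_ball] at hz hz'
      linarith [dist_triangle_left x y z]
  · intro h
    rcases ha.eq_or_lt with rfl | ha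
    · exact ⟨x, Or.inl rfl, Or.inr (by rw [Metric.mem_ball]; linarith)⟩
    rcases hb.eq_or_lt with rfl | hb
    · exact ⟨y, Or.inr (by rw [Metric.mem_ball, dist_comm]; linarith), Or.inl rfl⟩
    have : ¬ Disjoint (Metric.ball x a) (Metric.ball y b) := by
      rw [disjoint_ball_ball_iff ha hb]; linarith
    obtain ⟨z, hz⟩ := Set.not_disjoint_iff_nonempty_inter.1 this
    exact ⟨z, Or.inr hz.1, Or.inr hz.2⟩

theorem diskGraph_eq_bot_iff {ι : Type*} {p : ι → Plane} (hp : Function.Injective p) {r : ι → ℝ}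
    (hr : ∀ i, 0 ≤ r i) :
    diskGraph p r = ⊥ ↔ ∀ i j, i ≠ j → r i + r j ≤ dist (p i) (p j) := by
  rw [SimpleGraph.ext_iff, funext_iff]
  simp only [funext_iff, diskGraph, SimpleGraph.bot_adj, eq_iff_iff, iff_false, not_and]
  refine forall_congr' fun i => forall_congr' fun j => forall_congr' fun hij => ?_
  rw [openDisk_inter_nonempty_iff (fun h => hij (hp h)) (hr i) (hr j), not_lt]

/-- If `S` meets every pair of points at distance less than `2`, then at most `17 |S|` points have
another point at distance less than `2`. -/
theorem card_nonisolated_le {ι : Type*} [DecidableEq ι] (p : ι → Plane) (S V : Finset ι)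
    (hS : ∀ i j, i ≠ j → dist (p i) (p j) < 2 → i ∈ S ∨ j ∈ S)
    (hV : ∀ i ∈ V, ∃ j, i ≠ j ∧ dist (p i) (p j) < 2) : V.card ≤ 17 * S.card := by
  choose! f hf using hV
  -- A point of `V` outside `S` has a close neighbour in `S`, and the displacement lies in the open
  -- square of side 4, hence in one of 16 unit cells. The points of `S` itself account for the 17th.
  have hmaps : ((V \ S).card) ≤ (S ×ˢ (Finset.Icc (-2 : ℤ) 1 ×ˢ Finset.Icc (-2 : ℤ) 1)).card := by
    refine Finset.card_le_card_of_injOn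
      (fun i => (f i, ⌊p i 0 - p (f i) 0⌋, ⌊p i 1 - p (f i) 1⌋)) ?_ ?_
    · intro i hi
      have hi' := Finset.mem_sdiff.1 (Finset.mem_coe.1 hi)
      obtain ⟨hne, hd⟩ := hf i hi'.1
      have hd2 := hd
      rw [Plane.dist_eq, Real.sqrt_lt' two_pos] at hd2
      have h0 : -2 < p i 0 - p (f i) 0 ∧ p i 0 - p (f i) 0 < 2 := by
        constructor <;> nlinarith [mul_self_nonneg (p i 1 - p (f i) 1)]
      have h1 : -2 < p i 1 - p (f i) 1 ∧ p i 1 - p (f i) 1 < 2 := by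
        constructor <;> nlinarith [mul_self_nonneg (p i 0 - p (f i) 0)]
      simp only [Finset.coe_product, Set.mem_prod, Finset.mem_coe, Finset.mem_Icc]
      refine ⟨(hS _ _ hne hd).resolve_left hi'.2, ⟨?_, ?_⟩, ?_, ?_⟩
      · exact Int.le_floor.2 (by push_cast; exact h0.1.le)
      · exact Int.lt_add_one_iff.1 (Int.floor_lt.2 (by push_cast; linarith [h0.2]))
      · exact Int.le_floor.2 (by push_cast; exact h1.1.le)
      · exact Int.lt_add_one_iff.1 (Int.floor_lt.2 (by push_cast; linarith [h1.2]))
    -- Equal neighbour and equal cell put the two points at distance less than 2, so one of them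
    -- would belong to `S`.
    · intro i hi j hj hij
      by_contra hne
      simp only [Prod.mk.injEq] at hij
      obtain ⟨hfe, h0, h1⟩ := hij
      have e0 := Int.abs_sub_lt_one_of_floor_eq_floor h0
      have e1 := Int.abs_sub_lt_one_of_floor_eq_floor h1
      rw [hfe, sub_sub_sub_cancel_right] at e0 e1
      rw [abs_lt] at e0 e1
      have hd : dist (p i) (p j) < 2 := by
        rw [Plane.dist_eq, Real.sqrt_lt' two_pos]
        nlinarith
      rcases hS i j hne hd with h | h
      · exact (Finset.mem_sdiff.1 (Finset.mem_coe.1 hi)).2 h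
      · exact (Finset.mem_sdiff.1 (Finset.mem_coe.1 hj)).2 h
  rw [Finset.card_product, Finset.card_product] at hmaps
  have h4 : (Finset.Icc (-2 : ℤ) 1).card = 4 := by simp
  rw [h4] at hmaps
  have := Finset.card_sdiff_add_card V S
  have := Finset.card_le_card (Finset.subset_union_left (s₁ := V) (s₂ := S))
  omega

/-! ## The program -/

/-- Distance of two points given by their coordinates. -/
noncomputable def coordDist (X Y : ℕ → ℝ) (i j : ℕ) : ℝ :=
  √((X i - X j) * (X i - X j) + (Y i - Y j) * (Y i - Y j))

theorem coordDist_comm (X Y : ℕ → ℝ) (i j : ℕ) : coordDist X Y i j = coordDist X Y j i := by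
  unfold coordDist
  congr 1
  ring

namespace RealRAM

theorem WP.weaken {p : Prog} {T T' : ℕ} {Q : Store → Prop} {s : Store} (h : WP p T Q s)
    (hT : T ≤ T') : WP p T' Q s :=
  h.mono hT fun _ _ h => h

/-- The natural number in cell `0` of array `a`. -/
abbrev nvar (a : ℕ) : NExp := .read a (.lit 0)

/-- The real number in cell `0` of array `a`. -/
abbrev rvar (a : ℕ) : RExp := .read a (.lit 0)

/-- Distance of the input points with indices `i` and `j`. -/
def distExp (i j : NExp) : RExp :=
  .sqrt (.add (.mul (.sub (.read 1 i) (.read 1 j)) (.sub (.read 1 i) (.read 1 j)))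
    (.mul (.sub (.read 2 i) (.read 2 j)) (.sub (.read 2 i) (.read 2 j))))

@[simp] theorem distExp_eval (i j : NExp) (s : Store) :
    (distExp i j).eval s = coordDist (s.real 1) (s.real 2) (i.eval s) (j.eval s) := rfl

/-- The test `i ≠ j`. -/
def neTest (i j : NExp) : Test := .not (.and (.natLe i j) (.natLe j i))

@[simp] theorem neTest_holds (i j : NExp) (s : Store) :
    (neTest i j).Holds s ↔ i.eval s ≠ j.eval s := by
  simp only [neTest, Test.Holds]
  omega

variable {s : Store} {n : ℕ}

/-! ### Points with a close neighbour -/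

/-- Does the point with index in `nvar 3` have another point at distance less than `2`? -/
def closeProg : Prog :=
  .seq (.setNat 16 (.lit 0) (.lit 0))
    (forRange 4 0 0
      (.ite (.and (neTest (nvar 3) (nvar 4)) (.not (.realLe (.lit 2) (distExp (nvar 3) (nvar 4)))))
        (.setNat 16 (.lit 0) (.lit 1)) .skip))

/-- The budget of 200 per round, used for all simple loops, is generous; with the loop overhead it
gives the recurring 213. -/
theorem closeProg_spec {i : ℕ} (hn : s.nat 0 0 = n) (hi : s.nat 3 0 = i) :
    WP closeProg (213 * n + 13) (fun s' => 1 ≤ s'.nat 16 0 ↔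
      ∃ j < n, i ≠ j ∧ coordDist (s.real 1) (s.real 2) i j < 2) s := by
  refine (WP.seq (WP.setNat (WP.forRange (T := 200) (Inv := fun l s' => 1 ≤ s'.nat 16 0 ↔
      ∃ j < l, i ≠ j ∧ coordDist (s.real 1) (s.real 2) i j < 2) (by decide) (by decide)
      (by simpa using hn) ?_ ?_ ?_))).weaken ?_
  · intro l s' v h
    simpa using h
  · simp
  · intro l hl s' hs hc h
    have h3 : s'.nat 3 0 = i := by rw [hs.nat_eq 3 (by decide)]; simpa using hi
    have h1 : s'.real 1 = s.real 1 := hs.real_eq 1 (by decide)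
    have h2 : s'.real 2 = s.real 2 := hs.real_eq 2 (by decide)
    refine WP.weaken (T := 100) ?_ (by decide)
    refine (WP.ite (T := 3) (T' := 1) (fun hb => WP.setNat ?_) (fun hb => WP.skip ?_)).weaken
      (by decide)
    · simp [h1, h2, h3, hc] at hb
      simp
      exact ⟨l, by omega, hb⟩
    · simp [h1, h2, h3, hc] at hb
      rw [h]
      constructor
      · rintro ⟨j, hj, h⟩
        exact ⟨j, by omega, h⟩
      · rintro ⟨j, hj, h4, h5⟩
        rcases Nat.lt_succ_iff_lt_or_eq.1 hj with h | rfl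
        · exact ⟨j, h, h4, h5⟩
        · exact absurd h5 (not_lt.2 (hb h4))
  · simp only [NExp.cost]
    omega

/-- Collect the indices of the points with a close neighbour in array `6`. -/
def collectProg : Prog :=
  forRange 3 0 0
    (.seq closeProg
      (.ite (.natLe (.lit 1) (nvar 16))
        (.seq (.setNat 6 (nvar 5) (nvar 3)) (.setNat 5 (.lit 0) (.add (nvar 5) (.lit 1)))) .skip))

/-- `q 0, …, q (m - 1)` are the indices below `l` of the points with a close neighbour. -/
structure Collected (δ : ℕ → ℕ → ℝ) (n l m : ℕ) (q : ℕ → ℕ) : Prop where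
  le : m ≤ l
  lt : ∀ u < m, q u < l
  close : ∀ u < m, ∃ j < n, q u ≠ j ∧ δ (q u) j < 2
  injOn : Set.InjOn q (Set.Iio m)
  surj : ∀ i < l, (∃ j < n, i ≠ j ∧ δ i j < 2) → ∃ u < m, q u = i

theorem collectProg_spec (hn : s.nat 0 0 = n) (hm : s.nat 5 0 = 0) :
    WP collectProg (n * (213 * n + 100) + 10)
      (fun s' => Collected (coordDist (s.real 1) (s.real 2)) n n (s'.nat 5 0) (s'.nat 6)) s := by
  refine (WP.forRange (T := 213 * n + 13 + 60) (Inv := fun l s' =>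
    Collected (coordDist (s.real 1) (s.real 2)) n l (s'.nat 5 0) (s'.nat 6)) (by decide) (by decide)
    hn ?_ ?_ ?_).weaken ?_
  · intro l s' v h
    simpa using h
  · rw [hm]
    exact ⟨le_rfl, by simp, by simp, by simp, by simp⟩
  · intro l hl s' hs hc h
    have h1 : s'.real 1 = s.real 1 := hs.real_eq 1 (by decide)
    have h2 : s'.real 2 = s.real 2 := hs.real_eq 2 (by decide)
    refine WP.seq' (closeProg_spec (n := n) (i := l)
      (by rw [hs.nat_eq 0 (by decide), hn]) hc) ?_
    intro s₂ hs₂ h₂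
    rw [h1, h2] at h₂
    have h5 : s₂.nat 5 = s'.nat 5 := hs₂.nat_eq 5 (by decide)
    have h6 : s₂.nat 6 = s'.nat 6 := hs₂.nat_eq 6 (by decide)
    have h3 : s₂.nat 3 0 = l := by rw [hs₂.nat_eq 3 (by decide), hc]
    rw [← h5, ← h6] at h
    refine (WP.ite (T := 13) (T' := 1) (fun hb => (WP.seq (WP.setNat (WP.setNat ?_))).weaken
      (by decide)) (fun hb => WP.skip ?_)).weaken (by decide)
    · simp only [Test.Holds, NExp.eval] at hb
      rw [h₂] at hb
      simp only [NExp.eval, ne_eq, Nat.reduceEqDiff, not_false_eq_true,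
        Store.nat_writeNat_of_ne, Store.nat_writeNat_self, Function.update_self, h3]
      set m := s₂.nat 5 0
      set q := s₂.nat 6
      have hq : ∀ u < m, Function.update q m l u = q u := fun u hu =>
        Function.update_of_ne hu.ne _ _
      refine ⟨Nat.succ_le_succ h.le, ?_, ?_, ?_, ?_⟩
      · intro u hu
        rcases Nat.lt_succ_iff_lt_or_eq.1 hu with h' | rfl
        · rw [hq u h']; exact (h.lt u h').trans (Nat.lt_succ_self l)
        · simp
      · intro u hu
        rcases Nat.lt_succ_iff_lt_or_eq.1 hu with h' | rfl
        · rw [hq u h']; exact h.close u h'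
        · simpa using hb
      · intro u hu v hv huv
        rcases Nat.lt_succ_iff_lt_or_eq.1 (Set.mem_Iio.1 hu) with h' | rfl <;>
        rcases Nat.lt_succ_iff_lt_or_eq.1 (Set.mem_Iio.1 hv) with h'' | h''
        · rw [hq u h', hq v h''] at huv
          exact h.injOn h' h'' huv
        · subst h''
          rw [hq u h', Function.update_self] at huv
          exact absurd huv (h.lt u h').ne
        · rw [hq v h'', Function.update_self] at huv
          exact absurd huv.symm (h.lt v h'').ne
        · exact h''.symm
      · intro i hi hex
        rcases Nat.lt_succ_iff_lt_or_eq.1 hi with h' | rfl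
        · obtain ⟨u, hu, rfl⟩ := h.surj i h' hex
          exact ⟨u, by omega, hq u hu⟩
        · exact ⟨m, by omega, by simp⟩
    · simp only [Test.Holds, NExp.eval] at hb
      rw [h₂] at hb
      refine ⟨h.le.trans (Nat.le_succ l), fun u hu => (h.lt u hu).trans (Nat.lt_succ_self l),
        h.close, h.injOn, fun i hi hex => ?_⟩
      rcases Nat.lt_succ_iff_lt_or_eq.1 hi with h' | rfl
      · exact h.surj i h' hex
      · exact absurd hex hb
  · rw [show 213 * n + 13 + 60 + 13 = 213 * n + 86 by omega]
    gcongr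
    omega

/-- Write the list in array `6` a second time behind itself. -/
def doubleProg : Prog :=
  forRange 15 5 0 (.setNat 6 (.add (nvar 5) (nvar 15)) (.read 6 (nvar 15)))

/-- After doubling, the point of either copy of a variable is found by one look-up in the same list.
-/
theorem doubleProg_spec {m : ℕ} (hm : s.nat 5 0 = m) :
    WP doubleProg (213 * m + 10)
      (fun s' => (∀ u < m, s'.nat 6 (m + u) = s'.nat 6 u) ∧ ∀ u < m, s'.nat 6 u = s.nat 6 u) s := by
  refine (WP.forRange (T := 200) (Inv := fun l s' => (∀ u < l, s'.nat 6 (m + u) = s.nat 6 u) ∧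
    ∀ u < m, s'.nat 6 u = s.nat 6 u) (by decide) (by decide) hm ?_ ?_ ?_).mono ?_ ?_
  · intro l s' v h
    simpa using h
  · simp
  · rintro l hl s' hs hc ⟨h1, h2⟩
    refine (WP.setNat ?_).weaken (by decide)
    have h5 : s'.nat 5 0 = m := by rw [hs.nat_eq 5 (by decide), hm]
    simp only [NExp.eval, hc, h5, Store.nat_writeNat_self, h2 l hl]
    refine ⟨fun u hu => ?_, fun u hu => ?_⟩
    · rcases Nat.lt_succ_iff_lt_or_eq.1 hu with h' | rfl
      · rw [Function.update_of_ne (by omega)]; exact h1 u h'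
      · simp
    · rw [Function.update_of_ne (by omega)]; exact h2 u hu
  · omega
  · rintro s' - ⟨h1, h2⟩
    exact ⟨fun u hu => by rw [h1 u hu, h2 u hu], h2⟩

/-! ### Candidates -/

/-- One assignment of the straight-line evaluation encoded by the digits in array `10`. -/
def assignProg : Prog :=
  .ite (.natLe (.add (.read 10 (.add (nvar 7) (nvar 15))) (.lit 1)) (nvar 7))
    (.setReal 5 (.read 10 (nvar 15))
      (.sub (.sub (.lit 2) (distExp (.read 6 (.read 10 (nvar 15)))
        (.read 6 (.read 10 (.add (nvar 7) (nvar 15))))))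
        (.read 5 (.read 10 (.add (nvar 7) (nvar 15))))))
    (.ite (.natLe (.read 10 (.add (nvar 7) (nvar 15))) (nvar 7))
      (.setReal 5 (.read 10 (nvar 15)) (.sub (.lit 1) (rvar 0))) .skip)

/-- Straight-line evaluation. -/
def evalProg : Prog :=
  .seq (forRange 15 7 0 (.setReal 5 (nvar 15) (.lit 0))) (forRange 15 7 0 assignProg)

/-- Agreement is claimed only below `N`. Target digits may also hit cells `N` and `N + 1`, which are
never reset, but neither the assignments nor the radii read them. -/
theorem evalProg_spec {N : ℕ} (hN : s.nat 7 0 = N) :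
    WP evalProg (426 * N + 20) (fun s' => ∀ u < N, s'.real 5 u =
      straightLine (fun a c => 2 - coordDist (s.real 1) (s.real 2) (s.nat 6 a) (s.nat 6 c))
        (1 - s.real 0 0) N (s.nat 10) (fun j => s.nat 10 (N + j)) N u) s := by
  refine (WP.seq' (WP.forRange (N := N) (T := 200) (Inv := fun l s' => ∀ u < l, s'.real 5 u = 0)
    (by decide) (by decide) hN ?_ ?_ ?_) ?_).weaken (T := (N * (200 + 13) + 10) +
      (N * (200 + 13) + 10)) (by omega)
  · intro l s' v h
    simpa using h
  · simp
  · intro l hl s' hs hc h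
    refine (WP.setReal ?_).weaken (by decide)
    simp only [NExp.eval, RExp.eval, hc, Store.real_writeReal_self]
    intro u hu
    rcases Nat.lt_succ_iff_lt_or_eq.1 hu with h' | rfl
    · rw [Function.update_of_ne (by omega)]; exact h u h'
    · simp
  · intro s₁ hs₁ h₁
    set w : ℕ → ℕ → ℝ := fun a c => 2 - coordDist (s.real 1) (s.real 2) (s.nat 6 a) (s.nat 6 c)
      with hw
    refine WP.forRange (N := N) (T := 200) (Inv := fun l s' => ∀ u < N, s'.real 5 u =
      straightLine w (1 - s.real 0 0) N (s.nat 10) (fun j => s.nat 10 (N + j)) l u)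
      (by decide) (by decide) (by rw [hs₁.nat_eq 7 (by decide), hN]) ?_ ?_ ?_
    · intro l s' v h
      simpa using h
    · simpa [straightLine] using h₁
    · intro l hl s' hs hc h
      have hh : SameOutside [15] [5] s s' := (hs₁.mono (by decide) (by decide)).trans
        (hs.mono (by decide) (by decide))
      have h7 : s'.nat 7 0 = N := by rw [hh.nat_eq 7 (by decide), hN]
      have h10 : s'.nat 10 = s.nat 10 := hh.nat_eq 10 (by decide)
      have h6 : s'.nat 6 = s.nat 6 := hh.nat_eq 6 (by decide)
      have hr1 : s'.real 1 = s.real 1 := hh.real_eq 1 (by decide)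
      have hr2 : s'.real 2 = s.real 2 := hh.real_eq 2 (by decide)
      have hr0 : s'.real 0 = s.real 0 := hh.real_eq 0 (by decide)
      have upd : ∀ (f g : ℕ → ℝ) (a : ℕ) (y : ℝ), (∀ u < N, f u = g u) →
          ∀ u < N, Function.update f a y u = Function.update g a y u := by
        intro f g a y hfg u hu
        by_cases hua : u = a
        · simp [hua]
        · simp [hua, hfg u hu]
      refine (WP.ite (T := 100) (T' := 40) (fun hb => (WP.setReal ?_).weaken (by decide))
        (fun hb => (WP.ite (T := 11) (T' := 1) (fun hb' => (WP.setReal ?_).weaken (by decide))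
          (fun hb' => WP.skip ?_)).weaken (by decide))).weaken (by decide)
      · simp only [Test.Holds, NExp.eval, h7, hc, h10, Nat.add_one_le_iff] at hb
        simp only [straightLine, if_pos hb, NExp.eval, RExp.eval, distExp_eval, h7, hc, h10, h6,
          hr1, hr2, Store.real_writeReal_self, h _ hb]
        intro u hu
        rw [upd _ _ _ _ h u hu]
        norm_num [hw]
      · simp only [Test.Holds, NExp.eval, h7, hc, h10, Nat.add_one_le_iff] at hb hb'
        simp only [straightLine, if_neg hb, if_pos hb', NExp.eval, RExp.eval, hc, h10, hr0,
          Store.real_writeReal_self]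
        intro u hu
        rw [upd _ _ _ _ h u hu]
        norm_num
      · simp only [Test.Holds, NExp.eval, h7, hc, h10, Nat.add_one_le_iff] at hb hb'
        simp only [straightLine, if_neg hb, if_neg hb']
        exact h

/-- Radii from the values of the variables of the double cover. -/
def radiiProg : Prog :=
  .seq (forRange 3 0 0 (.setReal 4 (nvar 3) (.lit 1)))
    (forRange 15 5 0 (.setReal 4 (.read 6 (nvar 15))
      (.sub (.lit 1) (.div (.add (.read 5 (nvar 15)) (.read 5 (.add (nvar 5) (nvar 15))))
        (.lit 2)))))

theorem radiiProg_spec {m : ℕ} {x : ℕ → ℝ} (hn : s.nat 0 0 = n) (hm : s.nat 5 0 = m)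
    (hx : ∀ u < m + m, s.real 5 u = x u) :
    WP radiiProg (213 * n + 213 * m + 20)
      (fun s' => ∀ i < n, s'.real 4 i = radiiOf (s.nat 6) m x m i) s := by
  refine (WP.seq' (WP.forRange (N := n) (T := 200) (Inv := fun l s' => ∀ u < l, s'.real 4 u = 1)
    (by decide) (by decide) hn ?_ ?_ ?_) ?_).weaken (T := (n * (200 + 13) + 10) +
      (m * (200 + 13) + 10)) (by omega)
  · intro l s' v h
    simpa using h
  · simp
  · intro l hl s' hs hc h
    refine (WP.setReal ?_).weaken (by decide)
    simp only [NExp.eval, RExp.eval, hc, Store.real_writeReal_self]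
    intro u hu
    rcases Nat.lt_succ_iff_lt_or_eq.1 hu with h' | rfl
    · rw [Function.update_of_ne (by omega)]; exact h u h'
    · simp
  · intro s₁ hs₁ h₁
    refine WP.forRange (N := m) (T := 200) (Inv := fun l s' => ∀ i < n, s'.real 4 i =
      radiiOf (s.nat 6) m x l i) (by decide) (by decide) (by rw [hs₁.nat_eq 5 (by decide), hm])
      ?_ ?_ ?_
    · intro l s' v h
      simpa using h
    · simpa [radiiOf] using h₁
    · intro l hl s' hs hc h
      have hh : SameOutside [3, 15] [4] s s' := (hs₁.mono (by decide) (by decide)).trans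
        (hs.mono (by decide) (by decide))
      have h5 : s'.nat 5 0 = m := by rw [hh.nat_eq 5 (by decide), hm]
      have h6 : s'.nat 6 = s.nat 6 := hh.nat_eq 6 (by decide)
      have hr5 : s'.real 5 = s.real 5 := hh.real_eq 5 (by decide)
      refine (WP.setReal ?_).weaken (by decide)
      simp only [NExp.eval, RExp.eval, hc, h5, h6, hr5, radiiOf, Store.real_writeReal_self,
        hx l (by omega), hx (m + l) (by omega)]
      intro i hi
      by_cases hil : i = s.nat 6 l
      · simp [hil]
      · simp [hil, h i hi]

/-! ### Checking a candidate -/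

/-- Set the flag `nvar 13` to `0` if some radius is not in `[α, 1]`. -/
def rangeProg : Prog :=
  .seq (.setNat 13 (.lit 0) (.lit 1))
    (forRange 3 0 0 (.ite (.and (.realLe (rvar 0) (.read 4 (nvar 3)))
      (.realLe (.read 4 (nvar 3)) (.lit 1))) .skip (.setNat 13 (.lit 0) (.lit 0))))

theorem rangeProg_spec (hn : s.nat 0 0 = n) :
    WP rangeProg (213 * n + 13) (fun s' => 1 ≤ s'.nat 13 0 ↔
      ∀ i < n, s.real 0 0 ≤ s.real 4 i ∧ s.real 4 i ≤ 1) s := by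
  refine (WP.seq (WP.setNat (WP.forRange (T := 200) (Inv := fun l s' => 1 ≤ s'.nat 13 0 ↔
      ∀ i < l, s.real 0 0 ≤ s.real 4 i ∧ s.real 4 i ≤ 1) (by decide) (by decide)
      (by simpa using hn) ?_ ?_ ?_))).weaken ?_
  · intro l s' v h
    simpa using h
  · simp
  · intro l hl s' hs hc h
    have h0 : s'.real 0 = s.real 0 := hs.real_eq 0 (by decide)
    have h4 : s'.real 4 = s.real 4 := hs.real_eq 4 (by decide)
    refine (WP.ite (T := 1) (T' := 3) (fun hb => WP.skip ?_) (fun hb => WP.setNat ?_)).weaken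
      (by decide)
    · simp [h0, h4, hc] at hb
      rw [h]
      simp only [Nat.forall_lt_succ_right, hb, and_true]
    · simp [h0, h4, hc] at hb
      simp only [Nat.forall_lt_succ_right, NExp.eval, Store.nat_writeNat_self,
        Function.update_self]
      constructor
      · intro h; omega
      · rintro ⟨-, h1, h2⟩
        exact absurd h2 (not_le.2 (hb h1))
  · simp only [NExp.cost]
    omega

/-- Set the flag `nvar 13` to `0` if two disks intersect. -/
def pairsProg : Prog :=
  forRange 3 0 0 (forRange 4 0 0
    (.ite (.and (neTest (nvar 3) (nvar 4)) (.not (.realLe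
      (.add (.read 4 (nvar 3)) (.read 4 (nvar 4))) (distExp (nvar 3) (nvar 4)))))
      (.setNat 13 (.lit 0) (.lit 0)) .skip))

theorem pairsProg_spec (hn : s.nat 0 0 = n) :
    WP pairsProg (n * (213 * n + 23) + 10) (fun s' => 1 ≤ s'.nat 13 0 ↔ 1 ≤ s.nat 13 0 ∧
      ∀ i < n, ∀ j < n, i ≠ j →
        s.real 4 i + s.real 4 j ≤ coordDist (s.real 1) (s.real 2) i j) s := by
  refine (WP.forRange (N := n) (T := 213 * n + 10) (Inv := fun l s' => 1 ≤ s'.nat 13 0 ↔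
      1 ≤ s.nat 13 0 ∧ ∀ i < l, ∀ j < n, i ≠ j →
        s.real 4 i + s.real 4 j ≤ coordDist (s.real 1) (s.real 2) i j) (by decide) (by decide)
      hn ?_ ?_ ?_).weaken (by rfl)
  · intro l s' v h
    simpa using h
  · simp
  · intro i hi s₁ hs₁ hc₁ h₁
    refine (WP.forRange (N := n) (T := 200) (Inv := fun l s' => 1 ≤ s'.nat 13 0 ↔
      1 ≤ s₁.nat 13 0 ∧ ∀ j < l, i ≠ j →
        s.real 4 i + s.real 4 j ≤ coordDist (s.real 1) (s.real 2) i j) (by decide) (by decide)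
      (by rw [hs₁.nat_eq 0 (by decide), hn]) ?_ ?_ ?_).mono (by omega) ?_
    · intro l s' v h
      simpa using h
    · simp
    · intro l hl s' hs hc h
      have hh : SameOutside [3, 4, 13] [] s s' := (hs₁.mono (by decide) (by decide)).trans
        (hs.mono (by decide) (by decide))
      have h1 : s'.real 1 = s.real 1 := hh.real_eq 1 (by decide)
      have h2 : s'.real 2 = s.real 2 := hh.real_eq 2 (by decide)
      have h4 : s'.real 4 = s.real 4 := hh.real_eq 4 (by decide)
      have h3 : s'.nat 3 0 = i := by rw [hs.nat_eq 3 (by decide), hc₁]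
      refine (WP.ite (T := 3) (T' := 1) (fun hb => WP.setNat ?_) (fun hb => WP.skip ?_)).weaken
        (by decide)
      · simp [h1, h2, h3, h4, hc] at hb
        simp only [Nat.forall_lt_succ_right, NExp.eval, Store.nat_writeNat_self,
          Function.update_self]
        constructor
        · intro h; omega
        · rintro ⟨-, -, h⟩
          exact absurd (h hb.1) (not_le.2 hb.2)
      · simp [h1, h2, h3, h4, hc] at hb
        rw [h]
        simp only [Nat.forall_lt_succ_right]
        tauto
    · intro s' _ h
      rw [h, h₁, Nat.forall_lt_succ_right, and_assoc]

/-- Count the radii below `1`. -/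
def countProg : Prog :=
  .seq (.setNat 14 (.lit 0) (.lit 0))
    (forRange 3 0 0 (.ite (.realLe (.lit 1) (.read 4 (nvar 3))) .skip
      (.setNat 14 (.lit 0) (.add (nvar 14) (.lit 1)))))

theorem countProg_spec (hn : s.nat 0 0 = n) :
    WP countProg (213 * n + 13) (fun s' => s'.nat 14 0 =
      ((Finset.range n).filter fun i => s.real 4 i < 1).card) s := by
  refine (WP.seq (WP.setNat (WP.forRange (T := 200) (Inv := fun l s' => s'.nat 14 0 =
      ((Finset.range l).filter fun i => s.real 4 i < 1).card) (by decide) (by decide)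
      (by simpa using hn) ?_ ?_ ?_))).weaken ?_
  · intro l s' v h
    simpa using h
  · simp
  · intro l hl s' hs hc h
    have h4 : s'.real 4 = s.real 4 := hs.real_eq 4 (by decide)
    refine (WP.ite (T := 1) (T' := 6) (fun hb => WP.skip ?_) (fun hb => WP.setNat ?_)).weaken
      (by decide)
    · simp [h4, hc] at hb
      rw [h, Finset.range_add_one, Finset.filter_insert, if_neg (not_lt.2 hb)]
    · simp [h4, hc] at hb
      rw [Finset.range_add_one, Finset.filter_insert, if_pos hb,
        Finset.card_insert_of_notMem (by simp)]
      simp [h]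
  · simp only [NExp.cost]
    omega

/-- Compute the cost. -/
def costProg : Prog :=
  .seq (.setReal 6 (.lit 0) (.lit 0))
    (forRange 3 0 0 (.setReal 6 (.lit 0) (.add (rvar 6) (.sub (.lit 1) (.read 4 (nvar 3))))))

theorem costProg_spec (hn : s.nat 0 0 = n) :
    WP costProg (213 * n + 13) (fun s' => s'.real 6 0 =
      ∑ i ∈ Finset.range n, (1 - s.real 4 i)) s := by
  refine (WP.seq (WP.setReal (WP.forRange (T := 200) (Inv := fun l s' => s'.real 6 0 =
      ∑ i ∈ Finset.range l, (1 - s.real 4 i)) (by decide) (by decide)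
      (by simpa using hn) ?_ ?_ ?_))).weaken ?_
  · intro l s' v h
    simpa using h
  · simp
  · intro l hl s' hs hc h
    have h4 : s'.real 4 = s.real 4 := hs.real_eq 4 (by decide)
    refine (WP.setReal ?_).weaken (by decide)
    simp only [NExp.eval, RExp.eval, Store.real_writeReal_self, Function.update_self, h, h4, hc,
      Finset.sum_range_succ]
    norm_num
  · simp only [NExp.cost, RExp.cost]
    omega

end RealRAM

/-! ### Good radii and candidates, independently of the machine -/

/-- The cost of a choice of radii. -/
noncomputable def radiiCost (n : ℕ) (r : ℕ → ℝ) : ℝ := ∑ i ∈ Finset.range n, (1 - r i)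

theorem radiiCost_congr {n : ℕ} {r r' : ℕ → ℝ} (h : ∀ i < n, r i = r' i) :
    radiiCost n r = radiiCost n r' :=
  Finset.sum_congr rfl fun i hi => by rw [h i (Finset.mem_range.1 hi)]

/-- The radii `r` are those of a solution. -/
structure IsGood (δ : ℕ → ℕ → ℝ) (n k : ℕ) (α μ : ℝ) (r : ℕ → ℝ) : Prop where
  range : ∀ i < n, α ≤ r i ∧ r i ≤ 1
  disjoint : ∀ i < n, ∀ j < n, i ≠ j → r i + r j ≤ δ i j
  card_le : ((Finset.range n).filter fun i => r i < 1).card ≤ k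
  cost_le : radiiCost n r ≤ μ

theorem IsGood.congr {δ : ℕ → ℕ → ℝ} {n k : ℕ} {α μ : ℝ} {r r' : ℕ → ℝ}
    (hr : IsGood δ n k α μ r) (h : ∀ i < n, r' i = r i) : IsGood δ n k α μ r' where
  range i hi := by rw [h i hi]; exact hr.range i hi
  disjoint i hi j hj hij := by rw [h i hi, h j hj]; exact hr.disjoint i hi j hj hij
  card_le := by
    refine le_of_eq_of_le (congrArg Finset.card (Finset.filter_congr fun i hi => ?_)) hr.card_le
    rw [h i (Finset.mem_range.1 hi)]
  cost_le := by rw [radiiCost_congr h]; exact hr.cost_le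

/-- The radii encoded by the string `d` of digits. -/
noncomputable def candidate (δ : ℕ → ℕ → ℝ) (U : ℝ) (m : ℕ) (q d : ℕ → ℕ) : ℕ → ℝ :=
  radiiOf q m (straightLine (fun a c => 2 - δ (q a) (q c)) U (m + m) d
    (fun j => d (m + m + j)) (m + m)) m

theorem candidate_congr {δ : ℕ → ℕ → ℝ} {U : ℝ} {m : ℕ} {q d d' : ℕ → ℕ}
    (h : ∀ j < m + m + (m + m), d j = d' j) : candidate δ U m q d = candidate δ U m q d' := by
  unfold candidate
  rw [straightLine_congr (fun i hi => h i (by omega)) fun i hi => h (m + m + i) (by omega)]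

namespace RealRAM

variable {s : Store} {n : ℕ}

/-! ### Keeping the best candidate -/

/-- Check a candidate. -/
def checkProg : Prog := .seq rangeProg (.seq pairsProg (.seq countProg costProg))

/-- All conditions are tested on the radii themselves, so it does not matter how a candidate was
produced. -/
theorem checkProg_spec {k : ℕ} {μ : ℝ} (hn : s.nat 0 0 = n) :
    WP checkProg (1000 * (n + 1) ^ 2) (fun s' =>
      ((1 ≤ s'.nat 13 0 ∧ s'.nat 14 0 ≤ k ∧ s'.real 6 0 ≤ μ) ↔
        IsGood (coordDist (s.real 1) (s.real 2)) n k (s.real 0 0) μ (s.real 4)) ∧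
      s'.real 6 0 = radiiCost n (s.real 4)) s := by
  refine WP.weaken (T := (213 * n + 13) + ((n * (213 * n + 23) + 10) +
    ((213 * n + 13) + (213 * n + 13)))) ?_ (by nlinarith)
  refine WP.seq' (rangeProg_spec hn) fun s₁ hs₁ h₁ => ?_
  refine WP.seq' (pairsProg_spec (n := n) (by rw [hs₁.nat_eq 0 (by decide), hn]))
    fun s₂ hs₂ h₂ => ?_
  have hh₂ : SameOutside [3, 4, 13] [] s s₂ := (hs₁.mono (by decide) (by decide)).trans
    (hs₂.mono (by decide) (by decide))
  refine WP.seq' (countProg_spec (n := n) (by rw [hh₂.nat_eq 0 (by decide), hn]))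
    fun s₃ hs₃ h₃ => ?_
  have hh₃ : SameOutside [3, 4, 13, 14] [] s s₃ := (hh₂.mono (by decide) (by decide)).trans
    (hs₃.mono (by decide) (by decide))
  refine (costProg_spec (n := n) (by rw [hh₃.nat_eq 0 (by decide), hn])).mono le_rfl
    fun s₄ hs₄ h₄ => ?_
  rw [hh₃.real_eq 4 (by decide)] at h₄
  rw [hh₂.real_eq 4 (by decide)] at h₃
  rw [hs₁.real_eq 4 (by decide), hs₁.real_eq 1 (by decide), hs₁.real_eq 2 (by decide), h₁] at h₂
  rw [hs₄.nat_eq 13 (by decide), hs₄.nat_eq 14 (by decide), hs₃.nat_eq 13 (by decide), h₃, h₂, h₄]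
  refine ⟨⟨fun ⟨⟨h1, h2⟩, h3, h4⟩ => ⟨h1, h2, h3, h4⟩, fun h => ⟨⟨h.1, h.2⟩, h.3, h.4⟩⟩, rfl⟩

/-- The output arrays hold a cheapest one of those among the first `t` candidates that satisfy
`good`, if there is one. -/
def BestSoFar (n : ℕ) (good : (ℕ → ℝ) → Prop) (cand : ℕ → ℕ → ℝ) (t : ℕ) (s : Store) : Prop :=
  (s.nat 1 0 = 0 ∧ ∀ i < t, ¬ good (cand i)) ∨
  (s.nat 1 0 = 1 ∧ good (s.real 3) ∧ (∀ i < n, s.nat 2 i = if s.real 3 i < 1 then 1 else 0) ∧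
    s.real 7 0 = radiiCost n (s.real 3) ∧ ∀ i < t, good (cand i) → s.real 7 0 ≤ radiiCost n (cand i))

/-- Write the current candidate to the output arrays. -/
def saveProg : Prog :=
  .seq (.setNat 1 (.lit 0) (.lit 1)) (.seq (.setReal 7 (.lit 0) (rvar 6))
    (forRange 3 0 0 (.seq (.setReal 3 (nvar 3) (.read 4 (nvar 3)))
      (.ite (.realLe (.lit 1) (.read 4 (nvar 3))) (.setNat 2 (nvar 3) (.lit 0))
        (.setNat 2 (nvar 3) (.lit 1))))))

theorem saveProg_spec (hn : s.nat 0 0 = n) :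
    WP saveProg (213 * n + 18) (fun s' => s'.nat 1 0 = 1 ∧ s'.real 7 0 = s.real 6 0 ∧
      (∀ i < n, s'.real 3 i = s.real 4 i) ∧
      ∀ i < n, s'.nat 2 i = if s.real 4 i < 1 then 1 else 0) s := by
  refine (WP.seq (WP.setNat (WP.seq (WP.setReal (WP.forRange (T := 200)
    (Inv := fun l s' => s'.nat 1 0 = 1 ∧ s'.real 7 0 = s.real 6 0 ∧
      (∀ i < l, s'.real 3 i = s.real 4 i) ∧
      ∀ i < l, s'.nat 2 i = if s.real 4 i < 1 then 1 else 0) (by decide) (by decide)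
      (by simpa using hn) ?_ ?_ ?_))))).weaken ?_
  · intro l s' v h
    simpa using h
  · simp
  · rintro l hl s' hs hc ⟨h1, h7, h3, h2⟩
    have h4 : s'.real 4 = s.real 4 := hs.real_eq 4 (by decide)
    have hr3 : ∀ i < l + 1, Function.update (s'.real 3) l (s.real 4 l) i = s.real 4 i := by
      intro i hi
      rcases Nat.lt_succ_iff_lt_or_eq.1 hi with h' | rfl
      · rw [Function.update_of_ne h'.ne]; exact h3 i h'
      · simp
    have hr2 : ∀ i < l + 1, Function.update (s'.nat 2) l (if s.real 4 l < 1 then 1 else 0) i =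
        if s.real 4 i < 1 then 1 else 0 := by
      intro i hi
      rcases Nat.lt_succ_iff_lt_or_eq.1 hi with h' | rfl
      · rw [Function.update_of_ne h'.ne]; exact h2 i h'
      · simp
    refine (WP.seq (WP.setReal (WP.ite (T := 4) (T' := 4) (fun hb => WP.setNat ?_)
      (fun hb => WP.setNat ?_)))).weaken (by decide)
    · simp [h4, hc] at hb
      rw [if_neg (not_lt.2 hb)] at hr2
      have := And.intro hr3 hr2
      simpa [h4, hc, h1, h7] using this
    · simp [h4, hc] at hb
      rw [if_pos hb] at hr2
      have := And.intro hr3 hr2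
      simpa [h4, hc, h1, h7] using this
  · simp only [NExp.cost, RExp.cost]
    omega

/-- Save the current candidate if it is good and better than the saved one. -/
def acceptProg : Prog :=
  .ite (.and (.and (.natLe (.lit 1) (nvar 13)) (.and (.natLe (nvar 14) (.read 0 (.lit 1)))
      (.realLe (rvar 6) (.read 0 (.lit 1)))))
    (.not (.and (.natLe (.lit 1) (nvar 1)) (.realLe (rvar 7) (rvar 6))))) saveProg .skip

/-- The hypothesis `hcongr` is needed because memory and candidate agree only on the first `n`
radii. -/
theorem acceptProg_spec {good : (ℕ → ℝ) → Prop} {cand : ℕ → ℕ → ℝ} {t : ℕ}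
    (hn : s.nat 0 0 = n) (hcongr : ∀ r r', good r → (∀ i < n, r' i = r i) → good r')
    (hgood : (1 ≤ s.nat 13 0 ∧ s.nat 14 0 ≤ s.nat 0 1 ∧ s.real 6 0 ≤ s.real 0 1) ↔
      good (s.real 4)) (hcost : s.real 6 0 = radiiCost n (s.real 4))
    (hcand : ∀ i < n, s.real 4 i = cand t i) (hbest : BestSoFar n good cand t s) :
    WP acceptProg (213 * n + 100) (BestSoFar n good cand (t + 1)) s := by
  have hgc : good (cand t) ↔ good (s.real 4) :=
    ⟨fun h => hcongr _ _ h hcand, fun h => hcongr _ _ h fun i hi => (hcand i hi).symm⟩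
  have hcc : radiiCost n (cand t) = s.real 6 0 := by rw [hcost, radiiCost_congr hcand]
  refine (WP.ite (T := 213 * n + 18) (T' := 1)
    (fun hb => (saveProg_spec hn).mono le_rfl ?_) (fun hb => WP.skip ?_)).weaken
    (by simp only [Test.cost, NExp.cost, RExp.cost]; omega)
  · rintro s' - ⟨h1, h7, h3, h2⟩
    simp only [Test.Holds, NExp.eval, RExp.eval] at hb
    obtain ⟨hb1, hb2⟩ := hb
    rw [hgood] at hb1
    refine Or.inr ⟨h1, hcongr _ _ hb1 h3, fun i hi => by rw [h2 i hi, h3 i hi], ?_, ?_⟩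
    · rw [h7, hcost, radiiCost_congr h3]
    · intro i hi hg
      rw [h7]
      rcases Nat.lt_succ_iff_lt_or_eq.1 hi with h' | rfl
      · rcases hbest with ⟨_, h⟩ | ⟨h1', _, _, _, h⟩
        · exact absurd hg (h i h')
        · have : ¬ s.real 7 0 ≤ s.real 6 0 := fun h => hb2 ⟨h1'.ge, h⟩
          exact (not_le.1 this).le.trans (h i h' hg)
      · exact hcc.ge
  · simp only [Test.Holds, NExp.eval, RExp.eval, hgood] at hb
    have hb' : good (s.real 4) → 1 ≤ s.nat 1 0 ∧ s.real 7 0 ≤ s.real 6 0 := fun hg =>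
      by_contra fun hc => hb ⟨hg, hc⟩
    rcases hbest with ⟨h0, h⟩ | ⟨h1, hg, h2, h7, h⟩
    · refine Or.inl ⟨h0, fun i hi => ?_⟩
      rcases Nat.lt_succ_iff_lt_or_eq.1 hi with h' | rfl
      · exact h i h'
      · rw [hgc]
        intro hg
        have := (hb' hg).1
        omega
    · refine Or.inr ⟨h1, hg, h2, h7, fun i hi hgi => ?_⟩
      rcases Nat.lt_succ_iff_lt_or_eq.1 hi with h' | rfl
      · exact h i h' hgi
      · rw [hcc]
        exact (hb' (hgc.1 hgi)).2

/-- Evaluate the current string of digits and keep its radii if they are the best so far. -/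
def tryProg : Prog := .seq evalProg (.seq radiiProg (.seq checkProg acceptProg))

theorem tryProg_spec {m t : ℕ} {cand : ℕ → ℕ → ℝ} (hn : s.nat 0 0 = n) (hm : s.nat 5 0 = m)
    (hN : s.nat 7 0 = m + m) (hmn : m ≤ n)
    (hcand : cand t = candidate (coordDist (s.real 1) (s.real 2)) (1 - s.real 0 0) m (s.nat 6)
      (s.nat 10))
    (hbest : BestSoFar n (IsGood (coordDist (s.real 1) (s.real 2)) n (s.nat 0 1) (s.real 0 0)
      (s.real 0 1)) cand t s) :
    WP tryProg (3000 * (n + 1) ^ 2)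
      (BestSoFar n (IsGood (coordDist (s.real 1) (s.real 2)) n (s.nat 0 1) (s.real 0 0)
        (s.real 0 1)) cand (t + 1)) s := by
  refine WP.weaken (T := (426 * (m + m) + 20) + ((213 * n + 213 * m + 20) +
    (1000 * (n + 1) ^ 2 + (213 * n + 100)))) ?_
    (by linarith [show (n + 1) ^ 2 = n * n + 2 * n + 1 by ring, Nat.zero_le (n * n)])
  refine WP.seq' (evalProg_spec hN) fun s₁ hs₁ h₁ => ?_
  refine WP.seq' (radiiProg_spec (n := n) (by rw [hs₁.nat_eq 0 (by decide), hn])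
    (by rw [hs₁.nat_eq 5 (by decide), hm]) h₁) fun s₂ hs₂ h₂ => ?_
  have hh₂ : SameOutside [3, 15] [4, 5] s s₂ := (hs₁.mono (by decide) (by decide)).trans
    (hs₂.mono (by decide) (by decide))
  refine WP.seq' (checkProg_spec (n := n) (k := s.nat 0 1) (μ := s.real 0 1)
    (by rw [hh₂.nat_eq 0 (by decide), hn])) fun s₃ hs₃ h₃ => ?_
  have hh₃ : SameOutside [3, 4, 13, 14, 15] [4, 5, 6] s s₃ :=
    (hh₂.mono (by decide) (by decide)).trans (hs₃.mono (by decide) (by decide))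
  have h4 : s₃.real 4 = s₂.real 4 := hs₃.real_eq 4 (by decide)
  have h0 : s₃.nat 0 = s.nat 0 := hh₃.nat_eq 0 (by decide)
  have hr0 : s₃.real 0 = s.real 0 := hh₃.real_eq 0 (by decide)
  rw [hh₂.real_eq 0 (by decide), hh₂.real_eq 1 (by decide), hh₂.real_eq 2 (by decide)] at h₃
  refine acceptProg_spec (by rw [h0, hn]) (fun r r' h h' => h.congr h') ?_ ?_ ?_ ?_
  · rw [h4, h0, hr0]; exact h₃.1
  · rw [h4]; exact h₃.2
  · intro i hi
    rw [h4, h₂ i hi, hs₁.nat_eq 6 (by decide), hcand, candidate]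
  · unfold BestSoFar at hbest ⊢
    rwa [hh₃.nat_eq 1 (by decide), hh₃.nat_eq 2 (by decide), hh₃.real_eq 3 (by decide),
      hh₃.real_eq 7 (by decide)]

/-! ### Enumerating strings of digits -/

/-- Advance the odometer in array `10` (with `nvar 9` digits to the base `nvar 8`); on overflow set
the flag `nvar 12`. -/
def advanceProg : Prog :=
  .seq (.setNat 11 (.lit 0) (.lit 1))
    (.seq (forRange 4 9 0 (.ite (.natLe (.lit 1) (nvar 11))
        (.ite (.natLe (nvar 8) (.add (.read 10 (nvar 4)) (.lit 1)))
          (.setNat 10 (nvar 4) (.lit 0))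
          (.seq (.setNat 10 (nvar 4) (.add (.read 10 (nvar 4)) (.lit 1)))
            (.setNat 11 (.lit 0) (.lit 0)))) .skip))
      (.ite (.natLe (.lit 1) (nvar 11)) (.setNat 12 (.lit 0) (.lit 1)) .skip))

/-- For the odometer, with `t + 1` in place of `t`: the carry passes digit `l` exactly if it arrives
there and leaves a 0 behind. -/
theorem pow_succ_dvd_iff_mod {B l t : ℕ} :
    B ^ (l + 1) ∣ t ↔ B ^ l ∣ t ∧ t / B ^ l % B = 0 := by
  rw [← Nat.dvd_iff_mod_eq_zero, pow_succ]
  constructor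
  · intro h
    exact ⟨(Dvd.intro _ rfl).trans h, (Nat.dvd_div_iff_mul_dvd ((Dvd.intro _ rfl).trans h)).2 h⟩
  · rintro ⟨h, h'⟩
    exact (Nat.dvd_div_iff_mul_dvd h).1 h'

theorem advanceProg_spec {B D t : ℕ} (hB : s.nat 8 0 = B) (hB0 : 0 < B) (hD : s.nat 9 0 = D)
    (hd : ∀ j < D, s.nat 10 j = t / B ^ j % B) (h12 : s.nat 12 0 = 0) :
    WP advanceProg (213 * D + 30) (fun s' => (∀ j < D, s'.nat 10 j = (t + 1) / B ^ j % B) ∧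
      (1 ≤ s'.nat 12 0 ↔ B ^ D ∣ t + 1)) s := by
  refine WP.weaken (T := 3 + ((D * (200 + 13) + 10) + (5 + 1 + 3 + 1))) ?_ (by omega)
  refine WP.seq (WP.setNat ?_)
  -- Below `l` the digits are already those of `t + 1`, from `l` on still those of `t`; a pending
  -- carry means `B ^ l ∣ t + 1`.
  refine WP.seq' (WP.forRange (N := D) (T := 200) (Inv := fun l s' =>
    (∀ j < l, s'.nat 10 j = (t + 1) / B ^ j % B) ∧
    (∀ j < D, l ≤ j → s'.nat 10 j = t / B ^ j % B) ∧ (1 ≤ s'.nat 11 0 ↔ B ^ l ∣ t + 1))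
    (by decide) (by decide) (by simpa using hD) ?_ ?_ ?_) ?_
  · intro l s' v h
    simpa using h
  · simpa using hd
  · rintro l hl s' hs hc ⟨h1, h2, h3⟩
    have h8 : s'.nat 8 0 = B := by rw [hs.nat_eq 8 (by decide)]; simpa using hB
    have hdiv : (t + 1) / B ^ l = t / B ^ l + if B ^ l ∣ t + 1 then 1 else 0 := Nat.succ_div
    have hlt : t / B ^ l % B < B := Nat.mod_lt _ hB0
    have hupd : ∀ y, y = (t + 1) / B ^ l % B →
        (∀ j < l + 1, Function.update (s'.nat 10) l y j = (t + 1) / B ^ j % B) ∧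
        ∀ j < D, l + 1 ≤ j → Function.update (s'.nat 10) l y j = t / B ^ j % B := by
      rintro y rfl
      refine ⟨fun j hj => ?_, fun j hj hlj => ?_⟩
      · rcases Nat.lt_succ_iff_lt_or_eq.1 hj with h' | rfl
        · rw [Function.update_of_ne h'.ne]; exact h1 j h'
        · simp
      · rw [Function.update_of_ne (by omega)]; exact h2 j hj (by omega)
    refine (WP.ite (T := 100) (T' := 1) (fun hb => (WP.ite (T := 4) (T' := 20)
      (fun hb' => WP.setNat ?_) (fun hb' => (WP.seq (WP.setNat (WP.setNat ?_))).weaken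
      (by decide))).weaken (by decide)) (fun hb => WP.skip ?_)).weaken (by decide)
    · simp only [Test.Holds, NExp.eval, h8, hc, h2 l hl le_rfl, h3] at hb hb'
      rw [if_pos hb] at hdiv
      have hy : (t + 1) / B ^ l % B = 0 := by
        -- To the base 1 the only digit is 0.
        rcases Nat.lt_or_ge 1 B with h | h
        · rw [hdiv, Nat.add_mod_eq_ite, Nat.mod_eq_of_lt h, if_pos hb']; omega
        · rw [show B = 1 by omega, Nat.mod_one]
      obtain ⟨u1, u2⟩ := hupd 0 hy.symm
      simp only [NExp.eval, hc, Store.nat_writeNat_self, pow_succ_dvd_iff_mod]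
      refine ⟨u1, u2, ?_⟩
      simp [h3, hb, hy]
    · simp only [Test.Holds, NExp.eval, h8, hc, h2 l hl le_rfl, h3] at hb hb'
      rw [if_pos hb] at hdiv
      have hy : (t + 1) / B ^ l % B = t / B ^ l % B + 1 := by
        rw [hdiv, Nat.add_mod_eq_ite, Nat.mod_eq_of_lt (show 1 < B by omega), if_neg hb']
      obtain ⟨u1, u2⟩ := hupd _ hy.symm
      simp only [NExp.eval, hc, h2 l hl le_rfl, pow_succ_dvd_iff_mod]
      simp only [ne_eq, Nat.reduceEqDiff, not_false_eq_true, Store.nat_writeNat_of_ne,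
        Store.nat_writeNat_self]
      refine ⟨u1, u2, ?_⟩
      simp [hy]
    · simp only [Test.Holds, NExp.eval, h3] at hb
      rw [if_neg hb, add_zero] at hdiv
      refine ⟨fun j hj => ?_, fun j hj hlj => h2 j hj (by omega), ?_⟩
      · rcases Nat.lt_succ_iff_lt_or_eq.1 hj with h' | rfl
        · exact h1 j h'
        · rw [hdiv]; exact h2 j hl le_rfl
      · rw [h3, pow_succ_dvd_iff_mod]
        simp [hb]
  · rintro s' hs ⟨h1, -, h3⟩
    have h12' : s'.nat 12 0 = 0 := by rw [hs.nat_eq 12 (by decide)]; simpa using h12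
    refine (WP.ite (T := 3) (T' := 1) (fun hb => WP.setNat ?_) (fun hb => WP.skip ?_)).weaken
      (by decide)
    · simp only [Test.Holds, NExp.eval, h3] at hb
      simpa [hb] using h1
    · simp only [Test.Holds, NExp.eval, h3] at hb
      simpa [hb, h12'] using h1

/-- Try all strings of digits. -/
def searchProg : Prog := .loop (.not (.natLe (.lit 1) (nvar 12))) (.seq tryProg advanceProg)

theorem searchProg_spec {m B D : ℕ} (hn : s.nat 0 0 = n) (hm : s.nat 5 0 = m)
    (hN : s.nat 7 0 = m + m) (hB : s.nat 8 0 = B) (hB0 : 0 < B) (hD : s.nat 9 0 = D)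
    (hDm : D = m + m + (m + m)) (hmn : m ≤ n) (h10 : ∀ j, s.nat 10 j = 0) (h12 : s.nat 12 0 = 0)
    (h1 : s.nat 1 0 = 0) :
    WP searchProg (B ^ D * (5000 * (n + 1) ^ 2) + 6)
      (BestSoFar n (IsGood (coordDist (s.real 1) (s.real 2)) n (s.nat 0 1) (s.real 0 0)
        (s.real 0 1)) (fun t => candidate (coordDist (s.real 1) (s.real 2)) (1 - s.real 0 0) m
          (s.nat 6) (fun j => t / B ^ j % B)) (B ^ D)) s := by
  set good := IsGood (coordDist (s.real 1) (s.real 2)) n (s.nat 0 1) (s.real 0 0) (s.real 0 1)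
    with hgood
  set cand : ℕ → ℕ → ℝ := fun t => candidate (coordDist (s.real 1) (s.real 2)) (1 - s.real 0 0) m
          (s.nat 6) (fun j => t / B ^ j % B) with hcand
  have hpos : 0 < B ^ D := pow_pos hB0 _
  refine (WP.loop (T := 3000 * (n + 1) ^ 2 + (213 * D + 30)) (N := B ^ D) (i := 0)
    (Inv := fun t s' => SameOutside [1, 2, 3, 4, 10, 11, 12, 13, 14, 15] [3, 4, 5, 6, 7] s s' ∧
      (∀ j < D, s'.nat 10 j = t / B ^ j % B) ∧ (1 ≤ s'.nat 12 0 ↔ t = B ^ D) ∧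
      BestSoFar n good cand t s') ?_ ?_ ?_ hpos.le ?_).mono ?_ fun s' _ h => h.2.2.2
  · rintro t ht s' ⟨-, -, h, -⟩
    simp only [Test.Holds, NExp.eval, h]
    exact ht.ne
  · rintro s' ⟨-, -, h, -⟩
    simp [h]
  · rintro t ht s' ⟨hs, hd, h12, hbest⟩
    have h5 : s'.nat 5 0 = m := by rw [hs.nat_eq 5 (by decide), hm]
    have h0 : s'.nat 0 = s.nat 0 := hs.nat_eq 0 (by decide)
    have h6 : s'.nat 6 = s.nat 6 := hs.nat_eq 6 (by decide)
    have h7 : s'.nat 7 0 = m + m := by rw [hs.nat_eq 7 (by decide), hN]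
    have h8 : s'.nat 8 0 = B := by rw [hs.nat_eq 8 (by decide), hB]
    have h9 : s'.nat 9 0 = D := by rw [hs.nat_eq 9 (by decide), hD]
    have hr0 : s'.real 0 = s.real 0 := hs.real_eq 0 (by decide)
    have hr1 : s'.real 1 = s.real 1 := hs.real_eq 1 (by decide)
    have hr2 : s'.real 2 = s.real 2 := hs.real_eq 2 (by decide)
    refine WP.seq' (tryProg_spec (n := n) (t := t) (cand := cand) (by rw [h0, hn]) h5 h7 hmn ?_ ?_)
      fun s₁ hs₁ hb₁ => ?_
    · rw [hr0, hr1, hr2, h6, hcand]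
      exact candidate_congr fun j hj => (hd j (by omega)).symm
    · rw [hr0, hr1, hr2, h0]
      exact hbest
    rw [hr0, hr1, hr2, h0] at hb₁
    refine (advanceProg_spec (t := t) (by rw [hs₁.nat_eq 8 (by decide), h8]) hB0
      (by rw [hs₁.nat_eq 9 (by decide), h9])
      (by rw [hs₁.nat_eq 10 (by decide)]; exact hd) ?_).mono le_rfl fun s₂ hs₂ ⟨h, h'⟩ => ?_
    · rw [hs₁.nat_eq 12 (by decide)]
      by_contra hne
      exact ht.ne (h12.1 (by omega))
    · refine ⟨(hs.trans (hs₁.mono (by decide) (by decide))).trans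
        (hs₂.mono (by decide) (by decide)), h, ?_, ?_⟩
      · rw [h']
        -- Since `t + 1 ≤ B ^ D`, overflow occurs exactly when all strings have been tried.
        exact ⟨fun h => le_antisymm ht (Nat.le_of_dvd (Nat.succ_pos _) h), fun h => h ▸ dvd_rfl⟩
      · unfold BestSoFar at hb₁ ⊢
        rwa [hs₂.nat_eq 1 (by decide), hs₂.nat_eq 2 (by decide), hs₂.real_eq 3 (by decide),
          hs₂.real_eq 7 (by decide)]
  · refine ⟨.refl _ _ _, fun j _ => by simp [h10], ?_, Or.inl ⟨h1, by simp⟩⟩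
    rw [h12]
    omega
  · rw [Nat.sub_zero]
    refine Nat.add_le_add (Nat.mul_le_mul_left _ ?_) (by decide)
    simp only [Test.cost, NExp.cost]
    linarith [show (n + 1) ^ 2 = n * n + 2 * n + 1 by ring, Nat.zero_le (n * n)]

end RealRAM

/-! ### The complete program -/

namespace RealRAM

variable {s : Store} {n : ℕ}

/-- Compute the number of variables, the base and the number of digits. -/
def paramProg : Prog :=
  .seq (.setNat 7 (.lit 0) (.add (nvar 5) (nvar 5)))
    (.seq (.setNat 8 (.lit 0) (.add (nvar 7) (.lit 2)))
      (.setNat 9 (.lit 0) (.add (nvar 7) (nvar 7))))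

theorem paramProg_spec {m : ℕ} (hm : s.nat 5 0 = m) :
    WP paramProg 21 (fun s' => s'.nat 7 0 = m + m ∧ s'.nat 8 0 = m + m + 2 ∧
      s'.nat 9 0 = m + m + (m + m)) s := by
  refine (WP.seq (WP.setNat (WP.seq (WP.setNat (WP.setNat ?_))))).weaken (by decide)
  simp [hm]

/-- The number of close points a yes-instance has at most. -/
def boundExp : NExp :=
  let k : NExp := .read 0 (.lit 1)
  let dbl (e : NExp) : NExp := .add e e
  .add (dbl (dbl (dbl (dbl k)))) k

/-- Four doublings and one addition, as the machine does not multiply naturals. -/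
theorem boundExp_eval : boundExp.eval s = 17 * s.nat 0 1 := by
  simp only [boundExp, NExp.eval]
  omega

/-- The program for Min `k`-Shrinking to Independence. -/
def shrinkProg : Prog :=
  .seq collectProg (.ite (.natLe (nvar 5) boundExp)
    (.seq doubleProg (.seq paramProg searchProg)) .skip)

/-- The search runs only if `m ≤ 17k`, so the base is at most `34k + 2` and the number of digits at
most `68k`; this makes the bound independent of `m`. -/
theorem shrinkProg_spec {k : ℕ} (hn : s.nat 0 0 = n) (hk : s.nat 0 1 = k)
    (h0 : ∀ a j, a ≠ 0 → s.nat a j = 0) :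
    WP shrinkProg (6000 * (n + 1) ^ 2 * (34 * k + 2) ^ (68 * k)) (fun s' =>
      ∃ (m : ℕ) (q : ℕ → ℕ), Collected (coordDist (s.real 1) (s.real 2)) n n m q ∧
        (∀ u < m, q (m + u) = q u) ∧
        (17 * k < m → s'.nat 1 0 = 0) ∧
        (m ≤ 17 * k → BestSoFar n (IsGood (coordDist (s.real 1) (s.real 2)) n k (s.real 0 0)
          (s.real 0 1)) (fun t => candidate (coordDist (s.real 1) (s.real 2)) (1 - s.real 0 0) m
            q (fun j => t / (m + m + 2) ^ j % (m + m + 2))) ((m + m + 2) ^ (m + m + (m + m))) s'))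
      s := by
  have hK : 1 ≤ (34 * k + 2) ^ (68 * k) := Nat.one_le_pow _ _ (by omega)
  set K := (34 * k + 2) ^ (68 * k) with hKdef
  refine WP.weaken (T := (n * (213 * n + 100) + 10) + (100 + (213 * n + 10 +
    (21 + (K * (5000 * (n + 1) ^ 2) + 6))))) ?_ ?_
  · refine WP.seq' (collectProg_spec hn (h0 5 0 (by decide))) fun s₁ hs₁ h₁ => ?_
    have hk₁ : s₁.nat 0 1 = k := by rw [hs₁.nat_eq 0 (by decide), hk]
    set m := s₁.nat 5 0 with hm
    refine (WP.ite (T := 213 * n + 10 + (21 + (K * (5000 * (n + 1) ^ 2) + 6))) (T' := 1)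
      (fun hb => ?_) (fun hb => WP.skip ?_)).weaken (T' := 100 + (213 * n + 10 +
    (21 + (K * (5000 * (n + 1) ^ 2) + 6)))) ?_
    · simp only [Test.Holds, boundExp_eval, hk₁, NExp.eval] at hb
      rw [← hm] at hb
      have hmn : m ≤ n := h₁.le
      refine WP.seq' ((doubleProg_spec hm.symm).weaken (by omega)) fun s₂ hs₂ ⟨h₂, h₂'⟩ => ?_
      refine WP.seq' (paramProg_spec (m := m) (by rw [hs₂.nat_eq 5 (by decide)]))
        fun s₃ hs₃ ⟨h7, h8, h9⟩ => ?_
      have hh₃ : SameOutside [3, 4, 5, 6, 7, 8, 9, 15, 16] [] s s₃ :=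
        ((hs₁.mono (by decide) (by decide)).trans (hs₂.mono (by decide) (by decide))).trans
        (hs₃.mono (by decide) (by decide))
      have hz : ∀ a ∉ [0, 3, 4, 5, 6, 7, 8, 9, 15, 16], ∀ j, s₃.nat a j = 0 := by
        intro a ha j
        rw [List.mem_cons, not_or] at ha
        rw [hh₃.nat_eq a ha.2, h0 a j ha.1]
      refine (searchProg_spec (n := n) (m := m) (by rw [hh₃.nat_eq 0 (by decide), hn])
        (by rw [hs₃.nat_eq 5 (by decide), hs₂.nat_eq 5 (by decide)]) h7 h8 (by omega) h9 rfl hmn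
        (hz 10 (by decide)) (hz 12 (by decide) 0) (hz 1 (by decide) 0)).mono ?_ fun s₄ hs₄ h₄ => ?_
      · gcongr
        calc (m + m + 2) ^ (m + m + (m + m)) ≤ (34 * k + 2) ^ (m + m + (m + m)) :=
              Nat.pow_le_pow_left (by omega) _
          _ ≤ K := Nat.pow_le_pow_right (by omega) (by omega)
      · rw [hh₃.real_eq 0 (by decide), hh₃.real_eq 1 (by decide), hh₃.real_eq 2 (by decide),
          hh₃.nat_eq 0 (by decide), hk, hs₃.nat_eq 6 (by decide)] at h₄
        refine ⟨m, s₂.nat 6, ⟨h₁.le, ?_, ?_, ?_, ?_⟩, h₂, fun h => absurd h (not_lt.2 hb),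
          fun _ => h₄⟩
        · intro u hu; rw [h₂' u hu]; exact h₁.lt u hu
        · intro u hu; rw [h₂' u hu]; exact h₁.close u hu
        · intro u hu v hv huv
          rw [h₂' u hu, h₂' v hv] at huv
          exact h₁.injOn hu hv huv
        · intro i hi hex
          obtain ⟨u, hu, rfl⟩ := h₁.surj i hi hex
          exact ⟨u, hu, h₂' u hu⟩
    · simp only [Test.Holds, boundExp_eval, hk₁, NExp.eval] at hb
      rw [← hm] at hb
      -- On rejection the list was never doubled in memory, so its second half is supplied by hand.
      refine ⟨m, fun u => if u < m then s₁.nat 6 u else s₁.nat 6 (u - m), ⟨h₁.le, ?_, ?_, ?_, ?_⟩,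
        ?_, fun _ => ?_, fun h => absurd h hb⟩
      · intro u hu; rw [if_pos hu]; exact h₁.lt u hu
      · intro u hu; rw [if_pos hu]; exact h₁.close u hu
      · intro u hu v hv huv
        simp only [if_pos (Set.mem_Iio.1 hu), if_pos (Set.mem_Iio.1 hv)] at huv
        exact h₁.injOn hu hv huv
      · intro i hi hex
        obtain ⟨u, hu, rfl⟩ := h₁.surj i hi hex
        exact ⟨u, hu, if_pos hu⟩
      · intro u hu; simp [hu]
      · rw [hs₁.nat_eq 1 (by decide), h0 1 0 (by decide)]
    · have : (Test.natLe (nvar 5) boundExp).cost + 1 + 1 ≤ 100 := by decide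
      omega
  · have h2 : (n + 1) ^ 2 = n * n + 2 * n + 1 := by ring
    have h3 : (n + 1) ^ 2 ≤ K * (n + 1) ^ 2 := Nat.le_mul_of_pos_left _ hK
    linarith [Nat.zero_le (n * n)]

end RealRAM

/-! ### Size and coding of the search space -/

/-- Every string of `D` digits to the base `B` is that of a number below `B ^ D`. -/
theorem exists_digits {B D : ℕ} (d : ℕ → ℕ) (hd : ∀ j < D, d j < B) :
    ∃ t < B ^ D, ∀ j < D, t / B ^ j % B = d j := by
  set f : Fin D → Fin B := fun j => ⟨d j, hd j j.2⟩ with hf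
  refine ⟨finFunctionFinEquiv f, (finFunctionFinEquiv f).2, fun j hj => ?_⟩
  have : finFunctionFinEquiv.symm (finFunctionFinEquiv f) ⟨j, hj⟩ = f ⟨j, hj⟩ := by
    rw [Equiv.symm_apply_apply]
  exact congrArg Fin.val this

/-- For `k ≥ 2` one has `34k + 2 ≤ 36k ≤ k ^ 7`, whence the exponent `7 · 68 = 476`. The factor `36
^ 68` is needed for `k = 1`, where powers of `k` do not grow. -/
theorem searchSpace_le (k : ℕ) : (34 * k + 2) ^ (68 * k) ≤ 36 ^ 68 * k ^ (476 * k) := by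
  rcases Nat.lt_or_ge k 2 with hk | hk
  · interval_cases k
    · simp
    · simp
  · have h6 : 36 ≤ k ^ 6 := (by norm_num : 36 ≤ 2 ^ 6).trans (Nat.pow_le_pow_left hk 6)
    have h7 : 34 * k + 2 ≤ k ^ 7 := by
      calc 34 * k + 2 ≤ 36 * k := by omega
        _ ≤ k ^ 6 * k := Nat.mul_le_mul_right _ h6
        _ = k ^ 7 := by ring
    calc (34 * k + 2) ^ (68 * k) ≤ (k ^ 7) ^ (68 * k) := Nat.pow_le_pow_left h7 _
      _ = k ^ (476 * k) := by rw [← pow_mul]; congr 1; ring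
      _ ≤ 36 ^ 68 * k ^ (476 * k) := Nat.le_mul_of_pos_left _ (by positivity)

/-! ### Solutions versus candidates -/

namespace MinShrinkInstance

/-- Distances of the points of an instance, by index. -/
noncomputable def inputDist (I : MinShrinkInstance) : ℕ → ℕ → ℝ :=
  coordDist (I.input.real 1) (I.input.real 2)

variable {I : MinShrinkInstance}

theorem inputDist_eq (i j : Fin I.n) : I.inputDist i j = dist (I.point i) (I.point j) := by
  simp [inputDist, coordDist, input, Plane.dist_eq]

theorem IsSolution.nonneg {S : Finset (Fin I.n)} {r : Fin I.n → ℝ} (h : I.IsSolution S r)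
    (i : Fin I.n) : 0 ≤ r i := by
  by_cases hi : i ∈ S
  · exact I.α_nonneg.trans (h.radius_of_mem i hi).1
  · rw [h.radius_of_notMem i hi]; exact zero_le_one

theorem IsSolution.add_le_dist {S : Finset (Fin I.n)} {r : Fin I.n → ℝ} (h : I.IsSolution S r) :
    ∀ i j, i ≠ j → r i + r j ≤ dist (I.point i) (I.point j) :=
  (diskGraph_eq_bot_iff I.point_injective h.nonneg).1 h.edgeless

/-- Two points outside `S` keep radius 1, so they must be at distance at least 2: `S` is a vertex
cover of the close pairs. -/
theorem IsSolution.mem_or_mem {S : Finset (Fin I.n)} {r : Fin I.n → ℝ} (h : I.IsSolution S r)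
    (i j : Fin I.n) (hij : i ≠ j) (hd : dist (I.point i) (I.point j) < 2) : i ∈ S ∨ j ∈ S := by
  by_contra! hc
  have := h.add_le_dist i j hij
  rw [h.radius_of_notMem i hc.1, h.radius_of_notMem j hc.2] at this
  linarith

theorem IsSolution.solCost_eq {S : Finset (Fin I.n)} {r : Fin I.n → ℝ} (h : I.IsSolution S r) :
    solCost S r = ∑ i, (1 - r i) :=
  Finset.sum_subset (Finset.subset_univ S) fun i _ hi => by
    rw [h.radius_of_notMem i hi, sub_self]

/-- In a yes-instance few points have a close neighbour. -/
theorem IsSolution.card_collected_le {S : Finset (Fin I.n)} {r : Fin I.n → ℝ}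
    (h : I.IsSolution S r) {m : ℕ} {q : ℕ → ℕ} (hq : RealRAM.Collected I.inputDist I.n I.n m q) :
    m ≤ 17 * I.k := by
  have hinj : Function.Injective fun u : Fin m => (⟨q u, hq.lt u u.2⟩ : Fin I.n) := by
    intro u v huv
    exact Fin.ext (hq.injOn u.2 v.2 (congrArg Fin.val huv))
  have := card_nonisolated_le I.point S (Finset.univ.image fun u : Fin m => ⟨q u, hq.lt u u.2⟩)
    h.mem_or_mem (by
      intro i hi
      obtain ⟨u, -, rfl⟩ := Finset.mem_image.1 hi
      obtain ⟨j, hj, hne, hd⟩ := hq.close u u.2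
      refine ⟨⟨j, hj⟩, fun he => hne (congrArg Fin.val he), ?_⟩
      rwa [← inputDist_eq])
  rw [Finset.card_image_of_injective _ hinj, Finset.card_univ, Fintype.card_fin] at this
  exact this.trans (Nat.mul_le_mul_left _ h.card_le)

/-- For every solution there is a candidate that is a solution and costs no more. -/
theorem IsSolution.exists_candidate {S : Finset (Fin I.n)} {r : Fin I.n → ℝ}
    (h : I.IsSolution S r) {m : ℕ} {q : ℕ → ℕ} (hq : RealRAM.Collected I.inputDist I.n I.n m q)
    (hqm : ∀ u < m, q (m + u) = q u) :
    ∃ t < (m + m + 2) ^ (m + m + (m + m)), ∀ c, c = candidate I.inputDist (1 - I.α) m q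
      (fun j => t / (m + m + 2) ^ j % (m + m + 2)) →
      IsGood I.inputDist I.n I.k I.α I.μ c ∧ radiiCost I.n c ≤ solCost S r := by
  set x : ℕ → ℝ := fun i => if hi : i < I.n then 1 - r ⟨i, hi⟩ else 0 with hx
  have hxi : ∀ i (hi : i < I.n), x i = 1 - r ⟨i, hi⟩ := fun i hi => by simp [hx, hi]
  have hr : ∀ i, I.α ≤ r i ∧ r i ≤ 1 := by
    intro i
    by_cases hi : i ∈ S
    · exact h.radius_of_mem i hi
    · rw [h.radius_of_notMem i hi]; exact ⟨I.α_le_one, le_rfl⟩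
  obtain ⟨v, src, hv, hs, hmain⟩ := exists_straightLine_radii (n := I.n) (m := m) (q := q)
    (δ := I.inputDist) (U := 1 - I.α) (x := x) (fun i j => coordDist_comm _ _ i j) hq.lt hq.injOn
    hqm (fun i hi j hj hij hd => hq.surj i hi ⟨j, hj, hij, hd⟩)
    (fun i hi => by rw [hxi i hi]; linarith [(hr ⟨i, hi⟩).2])
    (fun i hi => by rw [hxi i hi]; linarith [(hr ⟨i, hi⟩).1])
    (fun i hi j hj hij => by
      have := h.add_le_dist ⟨i, hi⟩ ⟨j, hj⟩ fun he => hij (congrArg Fin.val he)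
      rw [← inputDist_eq] at this
      rw [hxi i hi, hxi j hj]
      linarith)
  -- The first half of the string lists the targets of the assignments, the second half their
  -- sources.
  obtain ⟨t, ht, hdig⟩ := exists_digits (B := m + m + 2) (D := m + m + (m + m))
    (fun j => if j < m + m then v j else src (j - (m + m)))
    (fun j _ => by split_ifs; exacts [hv _, hs _])
  refine ⟨t, ht, ?_⟩
  rintro c rfl
  obtain ⟨h1, h2, h3, h4⟩ := hmain _ rfl
  have hc : candidate I.inputDist (1 - I.α) m q
      (fun j => t / (m + m + 2) ^ j % (m + m + 2)) = radiiOf q m (straightLine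
        (fun a c => 2 - I.inputDist (q a) (q c)) (1 - I.α) (m + m) v src (m + m)) m := by
    rw [candidate_congr hdig, candidate]
    congr 1
    exact straightLine_congr (fun i hi => if_pos hi) fun i hi => by simp
  rw [hc]
  set c := radiiOf q m (straightLine
        (fun a c => 2 - I.inputDist (q a) (q c)) (1 - I.α) (m + m) v src (m + m)) m
  have hcost : radiiCost I.n c ≤ solCost S r := by
    refine h4.trans (le_of_eq ?_)
    rw [h.solCost_eq, ← Fin.sum_univ_eq_sum_range]
    exact Finset.sum_congr rfl fun i _ => hxi i i.2
  refine ⟨⟨fun i hi => ⟨by linarith [(h1 i hi).2], (h1 i hi).1⟩, h2, ?_,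
    hcost.trans h.cost_le⟩, hcost⟩
  -- The candidate shrinks only points that `r` shrinks, so it inherits the cardinality bound from
  -- `S`.
  refine le_trans ?_ (Finset.card_image_le.trans h.card_le : (S.image Fin.val).card ≤ I.k)
  refine Finset.card_le_card fun i hi => ?_
  obtain ⟨hi, hci⟩ := Finset.mem_filter.1 hi
  have hi' := Finset.mem_range.1 hi
  refine Finset.mem_image.2 ⟨⟨i, hi'⟩, ?_, rfl⟩
  by_contra hS
  apply h3 i hi' hci
  rw [hxi i hi', h.radius_of_notMem _ hS, sub_self]

/-- Good radii are those of a solution. -/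
theorem isSolution_of_isGood {r : ℕ → ℝ} (h : IsGood I.inputDist I.n I.k I.α I.μ r) :
    I.IsSolution (Finset.univ.filter fun i : Fin I.n => r i < 1) (fun i => r i) where
  card_le := by
    refine le_trans ?_ h.card_le
    rw [← Finset.card_map Fin.valEmbedding]
    refine Finset.card_le_card fun i hi => ?_
    obtain ⟨j, hj, rfl⟩ := Finset.mem_map.1 hi
    exact Finset.mem_filter.2 ⟨Finset.mem_range.2 j.2, (Finset.mem_filter.1 hj).2⟩
  radius_of_notMem i hi := by
    refine le_antisymm (h.range i i.2).2 (not_lt.1 fun hlt => hi ?_)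
    exact Finset.mem_filter.2 ⟨Finset.mem_univ _, hlt⟩
  radius_of_mem i _ := h.range i i.2
  edgeless := by
    rw [diskGraph_eq_bot_iff I.point_injective fun i => I.α_nonneg.trans (h.range i i.2).1]
    intro i j hij
    rw [← inputDist_eq]
    exact h.disjoint i i.2 j j.2 fun he => hij (Fin.ext he)
  cost_le := by
    refine le_trans ?_ h.cost_le
    rw [radiiCost, ← Fin.sum_univ_eq_sum_range (fun i => 1 - r i)]
    exact Finset.sum_le_sum_of_subset_of_nonneg (Finset.subset_univ _) fun i _ _ =>
      sub_nonneg.2 (h.range i i.2).2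

end MinShrinkInstance

theorem mainTheorem9 :
    ∃ (prog : RealRAM.Prog) (C c : ℕ), ∀ I : MinShrinkInstance,
      ∃ (t : ℕ) (s : RealRAM.Store),
        RealRAM.Run prog I.input t s ∧
        t ≤ C * I.k ^ (c * I.k) * (I.n + 1) ^ c ∧
        (I.IsYes →
          MinShrinkInstance.outAnswer s = 1 ∧
          I.IsOptimalSolution (MinShrinkInstance.outSet I.n s)
            (MinShrinkInstance.outRadius I.n s)) ∧
        (¬ I.IsYes → MinShrinkInstance.outAnswer s = 0) := by
  -- One constant serves as both exponents: 476 is forced by `searchSpace_le`, while 2 would do for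
  -- `n + 1`.
  refine ⟨RealRAM.shrinkProg, 6000 * 36 ^ 68, 476, fun I => ?_⟩
  obtain ⟨t, s, hrun, ht, m, q, hq, hqm, hno, hyes⟩ := RealRAM.shrinkProg_spec (s := I.input)
    (n := I.n) (k := I.k) rfl rfl (fun a j ha => by simp [MinShrinkInstance.input, ha])
  have hq : RealRAM.Collected I.inputDist I.n I.n m q := hq
  have hα : I.input.real 0 0 = I.α := by simp [MinShrinkInstance.input]
  have hμ : I.input.real 0 1 = I.μ := by simp [MinShrinkInstance.input]
  rw [hα, hμ] at hyes
  refine ⟨t, s, hrun, ht.trans ?_, ?_⟩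
  · calc 6000 * (I.n + 1) ^ 2 * (34 * I.k + 2) ^ (68 * I.k)
        ≤ 6000 * (I.n + 1) ^ 476 * (36 ^ 68 * I.k ^ (476 * I.k)) := by
          gcongr
          · exact Nat.succ_le_succ (Nat.zero_le _)
          · norm_num
          · exact searchSpace_le _
      _ = 6000 * 36 ^ 68 * I.k ^ (476 * I.k) * (I.n + 1) ^ 476 := by
          generalize (I.n + 1) ^ 476 = a
          generalize I.k ^ (476 * I.k) = b
          ring
  by_cases hm : m ≤ 17 * I.k
  · rcases hyes hm with ⟨h0, hnone⟩ | ⟨h1, hgood, h2, h7, hopt⟩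
    · refine ⟨?_, fun _ => h0⟩
      rintro ⟨S, r, h⟩
      obtain ⟨t, ht, hc⟩ := h.exists_candidate hq hqm
      exact absurd (hc _ rfl).1 (hnone t ht)
    · have hsol := MinShrinkInstance.isSolution_of_isGood hgood
      have hset : MinShrinkInstance.outSet I.n s =
          Finset.univ.filter fun i : Fin I.n => s.real 3 i < 1 :=
        Finset.filter_congr fun i _ => by rw [h2 i i.2]; split_ifs with h <;> simp [h]
      rw [hset]
      refine ⟨fun _ => ⟨h1, hsol, fun S' r' h' => ?_⟩, fun h => absurd ⟨_, _, hsol⟩ h⟩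
      obtain ⟨t, ht, hc⟩ := h'.exists_candidate hq hqm
      obtain ⟨hg, hle⟩ := hc _ rfl
      -- Every competing solution costs at least as much as some good candidate, hence as the saved
      -- one.
      refine le_trans (le_of_eq ?_) ((hopt t ht hg).trans hle)
      rw [h7, radiiCost, ← Fin.sum_univ_eq_sum_range (fun i => 1 - s.real 3 i)]
      exact hsol.solCost_eq
  · refine ⟨?_, fun _ => hno (not_le.1 hm)⟩
    rintro ⟨S, r, h⟩
    exact absurd (h.card_collected_le hq) hm
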